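/- There exist absolute constants $c,C>0$ such that the following holds. Let $m\ge 1$, let $X_1,\dots,X_m:\Omega\to\Theta$ be independent random variables on a probability space $(\Omega,\mathbb P)$ with values in a measurable space $\Theta$, and let $\mathcal F$ be a set of real-valued measurable functions on $\Theta$. For a real random variable $Y$ put $\|Y\|_{\psi_2}=\inf\{a>0:\ \mathbb E(\exp(|Y|^2/a^2)-1)\le 1\}\in[0,\infty]$, and set $$d_{\psi_2}(f,g)=\max_{1\le i\le m}\|f(X_i)-g(X_i)\|_{\psi_2},\qquad \bar\Delta_{\psi_2}(\mathcal F)=\sup_{f\in\mathcal F}\max_{1\le i\le m}\|f(X_i)\|_{\psi_2},$$ $$\gamma_2(\mathcal F,d_{\psi_2})=\inf_{(T_n)}\ \sup_{f\in\mathcal F}\ \sum_{n=0}^\infty 2^{n/2}\inf_{g\in T_n}d_{\psi_2}(f,g)\in[0,\infty],$$ where the infimum is over all sequences $(T_n)_{n\ge0}$ of subsets of $\mathcal F$ with $|T_0|=1$ and $|T_n|\le 2^{2^n}$ for $n\ge1$. Let $$Z(f)=\Big|\frac1m\sum_{i=1}^m\big(f^2(X_i)-\mathbb E f^2(X_i)\big)\Big|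 .$$ Suppose that $\sigma,K>0$ satisfy $$\sup_{f\in\mathcal F}\frac1m\sum_{i=1}^m\mathbb E\,|f^2(X_i)-\mathbb E f^2(X_i)|^q\le\frac{q!}{2}\sigma^2K^{q-2}\qquad(q=2,3,\dots),$$ where in particular all these expectations are finite. Then for every finite subset $\mathcal G\subseteq\mathcal F$ (in particular for $\mathcal G=\mathcal F$ if $\mathcal F$ is finite) and every $u\ge1$, $$\mathbb P\Big(\sup_{f\in\mathcal G}Z(f)\ \ge\ C\Big(\frac1m\gamma_2^2(\mathcal F,d_{\psi_2})+\frac{\bar\Delta_{\psi_2}(\mathcal F)}{\sqrt m}\,\gamma_2(\mathcal F,d_{\psi_2})\Big)+c\Big(\sqrt u\,\frac{\sigma}{\sqrt m}+u\,\frac Km\Big)\Big)\le e^{-u},$$ where the threshold is a number in $[0,\infty]$, with the convention $\infty\cdot 0=0$ in the product $\bar\Delta_{\psi_2}(\mathcal F)\,\gamma_2(\mathcal F,d_{\psi_2})$. -/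

import Mathlib

open MeasureTheory ProbabilityTheory
open scoped ENNReal Nat

noncomputable section

/-- The Orlicz function `ψ_α(x) = exp(x^α) - 1`, for `x ≥ 0`. -/
def psi (α x : ℝ) : ℝ := Real.exp (x ^ α) - 1

/-- The Orlicz (quasi-)norm `‖Y‖_{ψ_α} = inf {c > 0 : E ψ_α(|Y| / c) ≤ 1}` of a random variable,
with values in `[0, ∞]`; it is `∞` exactly when no `c` is admissible. -/
def psiNorm {Ω : Type*} [MeasurableSpace Ω] (α : ℝ) (Y : Ω → ℝ) (μ : Measure Ω) : ℝ≥0∞ :=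
  ⨅ (c : ℝ) (_ : 0 < c) (_ : ∫⁻ ω, ENNReal.ofReal (psi α (|Y ω| / c)) ∂μ ≤ 1), ENNReal.ofReal c

/-- A sequence `(S n)` of subsets of `T` is admissible if `|S 0| = 1` and `|S n| ≤ 2^(2^n)` for
all `n ≥ 1`. -/
structure IsAdmissible {E : Type*} (T : Set E) (S : ℕ → Set E) : Prop where
  subset : ∀ n, S n ⊆ T
  card_zero : (S 0).encard = 1
  card_le : ∀ n, 1 ≤ n → (S n).encard ≤ ((2 ^ 2 ^ n : ℕ) : ℕ∞)

/-- The generic chaining functional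
`γ_α(T, d) = inf_S sup_{t ∈ T} ∑_{n ≥ 0} 2^{n/α} d(t, S n)`, the infimum being over all admissible
sequences `S` of subsets of `T`, where `d(t, S n) = inf_{s ∈ S n} d(t, s)`. -/
def gammaFunctional {E : Type*} (α : ℝ) (T : Set E) (d : E → E → ℝ≥0∞) : ℝ≥0∞ :=
  ⨅ (S : ℕ → Set E) (_ : IsAdmissible T S),
    ⨆ t ∈ T, ∑' n : ℕ, (2 : ℝ≥0∞) ^ ((n : ℝ) / α) * ⨅ s ∈ S n, d t s

section AverageOfSquares

variable {Ω Θ : Type*} [MeasurableSpace Ω] {m : ℕ}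

/-- The semi-metric `d_{ψ₂}(f, g) = max_i ‖f(X_i) - g(X_i)‖_{ψ₂}`. -/
def dPsi2 (X : Fin m → Ω → Θ) (μ : Measure Ω) (f g : Θ → ℝ) : ℝ≥0∞ :=
  ⨆ i, psiNorm 2 (fun ω => f (X i ω) - g (X i ω)) μ

/-- The radius `sup_{f ∈ F} max_i ‖f(X_i)‖_{ψ₂}`. -/
def radiusPsi2 (X : Fin m → Ω → Θ) (μ : Measure Ω) (F : Set (Θ → ℝ)) : ℝ≥0∞ :=
  ⨆ f ∈ F, ⨆ i, psiNorm 2 (fun ω => f (X i ω)) μ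

/-- `Z(f) = |(1/m) ∑_i (f²(X_i) - E f²(X_i))|`. -/
def avgSquares (X : Fin m → Ω → Θ) (μ : Measure Ω) (f : Θ → ℝ) (ω : Ω) : ℝ :=
  |(1 / (m : ℝ)) * ∑ i, (f (X i ω) ^ 2 - ∫ ω', f (X i ω') ^ 2 ∂μ)|

/-- The Bernstein moment condition
`sup_{f ∈ F} (1/m) ∑_i E |f²(X_i) - E f²(X_i)|^q ≤ (q!/2) σ² K^{q-2}` for all `q = 2, 3, …`.
The outer expectations take values in `[0, ∞]`. For measurable `f` and `X_i`, the case `q = 2`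
forces `f²(X_i)` to be square integrable: otherwise the left-hand side is infinite, whatever real
value stands for `E f²(X_i)`. So `E f²(X_i)` is a genuine expectation whenever this holds. -/
def BernsteinMoments (X : Fin m → Ω → Θ) (μ : Measure Ω) (F : Set (Θ → ℝ)) (σ K : ℝ) : Prop :=
  ∀ f ∈ F, ∀ q : ℕ, 2 ≤ q →
    (1 / (m : ℝ≥0∞)) * ∑ i, ∫⁻ ω, ENNReal.ofReal
        (|f (X i ω) ^ 2 - ∫ ω', f (X i ω') ^ 2 ∂μ| ^ q) ∂μ
      ≤ ENNReal.ofReal ((q ! : ℝ) / 2 * σ ^ 2 * K ^ (q - 2))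

end AverageOfSquares

end

/-! Generic chaining, with the deviation parameter paid for only once. Choose `l` with `2^l ≤ u <
2^(l+1)`. The level `T l` has at most `2^(2^l) ≤ e^u` elements, so Bernstein's inequality with `σ`
and `K` (`BernsteinMoments.measure_avgSquares_ge_le`) controls `Z` on all of it. Chains start at
level `l`, and every later link has failure probability at most `2 exp(-9·2^n)`, which beats both
the number of links and `e^{-u}`.

Links are treated in two regimes (`measure_incrementEvent_le`). While `2^n < m`, the squares `f² -
g²` are subexponential at scale `2 Δ d(f,g)`, and the Chernoff bound is still in its Gaussian range:
the increment of the sum is of order `Δ d(f,g) √(2^n m)`, which sums to `Δ √m γ`. Once `2^n ≥ m`,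
the same bound would cost `2^n d(f,g)`, which `γ₂` does not control. There only the empirical
Euclidean norm of `f - g` is bounded, by `4·2^(n/2) d(f,g)`; these norms sum to `4γ`. The squares at
the two ends of this upper part are then compared by Cauchy–Schwarz, the cross term being absorbed
by the sum at level `k` where the regimes meet (`chain_bound`).

Finiteness of `G` lets every chain end at `f` itself at a fixed level `N`, so no limit is taken. If
`γ₂` is finite, the moment condition makes the radius finite too (`radiusPsi2_lt_top`); if `γ₂` is
infinite, so is the threshold. -/

/-- The second order remainder `exp x - 1 - x` of the exponential series. -/
noncomputable def expRem (x : ℝ) : ℝ := Real.exp x - 1 - x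

lemma hasSum_expRem (x : ℝ) :
    HasSum (fun q : ℕ => x ^ (q + 2) / ((q + 2)! : ℝ)) (expRem x) := by
  have h := NormedSpace.expSeries_div_hasSum_exp x
  rw [← Real.exp_eq_exp_ℝ] at h
  have heq : expRem x = Real.exp x - ∑ i ∈ Finset.range 2, x ^ i / (i ! : ℝ) := by
    rw [Finset.sum_range_succ, Finset.sum_range_one]
    simp [expRem, sub_sub]
  rw [heq]
  exact (hasSum_nat_add_iff' 2).2 h

lemma expRem_nonneg (x : ℝ) : 0 ≤ expRem x := by
  have := Real.add_one_le_exp x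
  unfold expRem; linarith

lemma measurable_expRem : Measurable expRem := by
  unfold expRem; fun_prop

/-- For `x ≤ 0` this is `-x ≤ sinh (-x)`. -/
lemma exp_le_one_add_add_expRem_abs (x : ℝ) : Real.exp x ≤ 1 + x + expRem |x| := by
  unfold expRem
  rcases le_total 0 x with h | h
  · rw [abs_of_nonneg h]; linarith
  · rw [abs_of_nonpos h]
    have := Real.self_le_sinh_iff.2 (neg_nonneg.2 h)
    rw [Real.sinh_eq, neg_neg] at this
    linarith

/-- The series starts in degree two, so each term gains at least `θ²`. -/
lemma expRem_mul_le {θ z : ℝ} (hθ0 : 0 ≤ θ) (hθ1 : θ ≤ 1) (hz : 0 ≤ z) :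
    expRem (θ * z) ≤ θ ^ 2 * expRem z := by
  refine hasSum_le (fun q => ?_) (hasSum_expRem (θ * z)) ((hasSum_expRem z).mul_left (θ ^ 2))
  rw [mul_pow, ← mul_div_assoc]
  gcongr ?_ * _ / _
  exact pow_le_pow_of_le_one hθ0 hθ1 (by omega)

lemma exp_le_two_mul_expRem_add_one {x : ℝ} (hx : 0 ≤ x) :
    Real.exp x ≤ 2 * (expRem x + 1) := by
  have := Real.quadratic_le_exp_of_nonneg hx
  unfold expRem
  nlinarith [sq_nonneg (x - 1)]

/-! ### Exponential moments and Chernoff bounds -/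

section Exponential

variable {Ω : Type*} [MeasurableSpace Ω] {μ : Measure Ω}

lemma integrable_of_lintegral_ofReal_ne_top {g : Ω → ℝ} (hg : Measurable g) (h0 : ∀ ω, 0 ≤ g ω)
    (h : ∫⁻ ω, ENNReal.ofReal (g ω) ∂μ ≠ ∞) : Integrable g μ := by
  refine ⟨hg.aestronglyMeasurable, ?_⟩
  rw [hasFiniteIntegral_iff_ofReal (Filter.Eventually.of_forall h0)]
  exact lt_top_iff_ne_top.2 h

lemma integral_le_of_lintegral_ofReal_le {g : Ω → ℝ} (hg : Measurable g) (h0 : ∀ ω, 0 ≤ g ω)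
    {a : ℝ} (ha : 0 ≤ a) (h : ∫⁻ ω, ENNReal.ofReal (g ω) ∂μ ≤ ENNReal.ofReal a) :
    ∫ ω, g ω ∂μ ≤ a := by
  rw [integral_eq_lintegral_of_nonneg_ae (Filter.Eventually.of_forall h0)
    hg.aestronglyMeasurable]
  exact ENNReal.toReal_le_of_le_ofReal ha h

lemma integrable_exp_of_expRem [IsProbabilityMeasure μ] {Y : Ω → ℝ} (hY : Measurable Y)
    (hint : Integrable Y μ) {t : ℝ}
    (h : ∫⁻ ω, ENNReal.ofReal (expRem |t * Y ω|) ∂μ ≠ ∞) :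
    Integrable (fun ω => Real.exp (t * Y ω)) μ := by
  have hφ : Integrable (fun ω => expRem |t * Y ω|) μ :=
    integrable_of_lintegral_ofReal_ne_top (measurable_expRem.comp (by fun_prop))
      (fun ω => expRem_nonneg _) h
  refine (((integrable_const (1 : ℝ)).add (hint.const_mul t)).add hφ).mono'
    (by fun_prop) (Filter.Eventually.of_forall fun ω => ?_)
  rw [Real.norm_of_nonneg (Real.exp_pos _).le]
  exact exp_le_one_add_add_expRem_abs _

/-- Since `E exp(tY) ≤ 1 + t E Y + a ≤ exp(t E Y + a)`, centring cancels the linear term exactly.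
Only the remainder of the uncentred `Y` has to be estimated. -/
lemma mgf_sub_integral_le [IsProbabilityMeasure μ] {Y : Ω → ℝ} (hY : Measurable Y)
    (hint : Integrable Y μ) {t : ℝ}
    (h : ∫⁻ ω, ENNReal.ofReal (expRem |t * Y ω|) ∂μ ≠ ∞) :
    mgf (fun ω => Y ω - ∫ ω', Y ω' ∂μ) μ t ≤
      Real.exp (∫⁻ ω, ENNReal.ofReal (expRem |t * Y ω|) ∂μ).toReal := by
  set e := ∫ ω', Y ω' ∂μ
  have hm : Measurable (fun ω => expRem |t * Y ω|) := measurable_expRem.comp (by fun_prop)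
  have hφ : Integrable (fun ω => expRem |t * Y ω|) μ :=
    integrable_of_lintegral_ofReal_ne_top hm (fun ω => expRem_nonneg _) h
  rw [← integral_eq_lintegral_of_nonneg_ae (Filter.Eventually.of_forall fun ω => expRem_nonneg _)
    hm.aestronglyMeasurable]
  set a := ∫ ω, expRem |t * Y ω| ∂μ
  have h1 : ∫ ω, Real.exp (t * Y ω) ∂μ ≤ ∫ ω, (1 + t * Y ω + expRem |t * Y ω|) ∂μ :=
    integral_mono (integrable_exp_of_expRem hY hint h)
      (((integrable_const (1 : ℝ)).add (hint.const_mul t)).add hφ)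
      fun ω => exp_le_one_add_add_expRem_abs _
  have h2 : ∫ ω, (1 + t * Y ω + expRem |t * Y ω|) ∂μ = 1 + t * e + a := by
    have h1t : Integrable (fun ω => 1 + t * Y ω) μ :=
      (integrable_const (1 : ℝ)).add (hint.const_mul t)
    rw [integral_add h1t hφ, integral_add (integrable_const (1 : ℝ)) (hint.const_mul t), integral_const_mul]
    simp [e, a]
  have h3 : mgf (fun ω => Y ω - e) μ t = Real.exp (-(t * e)) * ∫ ω, Real.exp (t * Y ω) ∂μ := by
    rw [mgf, ← integral_const_mul]
    congr 1; ext ω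
    rw [← Real.exp_add]; ring_nf
  rw [h3]
  calc _ ≤ Real.exp (-(t * e)) * Real.exp (t * e + a) := by
        gcongr
        have := Real.add_one_le_exp (t * e + a)
        linarith
    _ = Real.exp a := by rw [← Real.exp_add]; ring_nf

lemma measure_le_ofReal_of_real_le [IsProbabilityMeasure μ] {s : Set Ω} {a : ℝ} (h : μ.real s ≤ a) :
    μ s ≤ ENNReal.ofReal a := by
  rw [← ENNReal.ofReal_toReal (measure_ne_top μ s)]
  exact ENNReal.ofReal_le_ofReal h

lemma measure_sum_sub_integral_ge_le [IsProbabilityMeasure μ] {ι : Type*} [Fintype ι]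
    {Y : ι → Ω → ℝ}
    (hY : ∀ i, Measurable (Y i)) (hind : iIndepFun Y μ) (hint : ∀ i, Integrable (Y i) μ)
    {t A : ℝ} (ht : 0 ≤ t) (hA0 : 0 ≤ A)
    (hA : ∑ i, ∫⁻ ω, ENNReal.ofReal (expRem |t * Y i ω|) ∂μ ≤ ENNReal.ofReal A) (s : ℝ) :
    μ {ω | s ≤ ∑ i, (Y i ω - ∫ ω', Y i ω' ∂μ)} ≤ ENNReal.ofReal (Real.exp (-t * s + A)) := by
  have hfin : ∀ i, ∫⁻ ω, ENNReal.ofReal (expRem |t * Y i ω|) ∂μ ≠ ∞ := fun i =>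
    ((Finset.single_le_sum (fun i _ => zero_le) (Finset.mem_univ i)).trans_lt
      (hA.trans_lt ENNReal.ofReal_lt_top)).ne
  have hind' : iIndepFun (fun i ω => Y i ω - ∫ ω', Y i ω' ∂μ) μ :=
    hind.comp (fun i x => x - ∫ ω', Y i ω' ∂μ) (fun i => by fun_prop)
  have hmeas : ∀ i, Measurable (fun ω => Y i ω - ∫ ω', Y i ω' ∂μ) := fun i => by
    have := hY i; fun_prop
  have hI : ∀ i, Integrable (fun ω => Real.exp (t * (Y i ω - ∫ ω', Y i ω' ∂μ))) μ := fun i => by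
    refine ((integrable_exp_of_expRem (hY i) (hint i) (hfin i)).const_mul
      (Real.exp (-(t * ∫ ω', Y i ω' ∂μ)))).congr (Filter.Eventually.of_forall fun ω => ?_)
    simp only
    rw [← Real.exp_add]; ring_nf
  have key := measure_ge_le_exp_mul_mgf (μ := μ)
    (X := ∑ i, fun ω => Y i ω - ∫ ω', Y i ω' ∂μ) s ht
    (hind'.integrable_exp_mul_sum hmeas fun i _ => hI i)
  rw [hind'.mgf_sum hmeas] at key
  simp only [Finset.sum_apply] at key
  refine measure_le_ofReal_of_real_le (key.trans ?_)
  rw [Real.exp_add]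
  gcongr
  calc _ ≤ ∏ i, Real.exp (∫⁻ ω, ENNReal.ofReal (expRem |t * Y i ω|) ∂μ).toReal :=
        Finset.prod_le_prod (fun i _ => mgf_nonneg)
          fun i _ => mgf_sub_integral_le (hY i) (hint i) (hfin i)
    _ = Real.exp (∑ i, ∫⁻ ω, ENNReal.ofReal (expRem |t * Y i ω|) ∂μ).toReal := by
        rw [← Real.exp_sum, ENNReal.toReal_sum fun i _ => hfin i]
    _ ≤ Real.exp A := by
        gcongr
        exact ENNReal.toReal_le_of_le_ofReal hA0 hA

/-- Two-sided Chernoff bound for sums of independent, not necessarily centred variables. -/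
lemma measure_abs_sum_sub_integral_ge_le [IsProbabilityMeasure μ] {ι : Type*} [Fintype ι]
    {Y : ι → Ω → ℝ}
    (hY : ∀ i, Measurable (Y i)) (hind : iIndepFun Y μ) (hint : ∀ i, Integrable (Y i) μ)
    {t A : ℝ} (ht : 0 ≤ t) (hA0 : 0 ≤ A)
    (hA : ∑ i, ∫⁻ ω, ENNReal.ofReal (expRem (t * |Y i ω|)) ∂μ ≤ ENNReal.ofReal A) (s : ℝ) :
    μ {ω | s ≤ |∑ i, (Y i ω - ∫ ω', Y i ω' ∂μ)|} ≤
      ENNReal.ofReal (2 * Real.exp (-t * s + A)) := by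
  have h1 := measure_sum_sub_integral_ge_le hY hind hint ht hA0
    (by simpa only [abs_mul, abs_of_nonneg ht] using hA) s
  have h2 := measure_sum_sub_integral_ge_le (Y := fun i ω => - Y i ω) (fun i => (hY i).neg)
    (hind.comp (fun _ x => -x) fun _ => measurable_neg) (fun i => (hint i).neg) ht hA0
    (by simpa only [abs_mul, abs_of_nonneg ht, abs_neg] using hA) s
  rw [two_mul, ENNReal.ofReal_add (Real.exp_pos _).le (Real.exp_pos _).le]
  refine (measure_mono ?_).trans ((measure_union_le _ _).trans (add_le_add h1 h2))
  intro ω hω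
  simp only [Set.mem_ofPred_eq, Set.mem_union] at hω ⊢
  rcases le_abs.1 hω with h | h
  · exact Or.inl h
  · right
    refine h.trans (le_of_eq ?_)
    rw [← Finset.sum_neg_distrib]
    refine Finset.sum_congr rfl fun i _ => ?_
    rw [integral_neg]; ring

/-- `E exp V ≤ 2`. -/
def ExpBound (μ : Measure Ω) (V : Ω → ℝ) : Prop :=
  ∫⁻ ω, ENNReal.ofReal (Real.exp (V ω)) ∂μ ≤ 2

lemma ExpBound.mono {V W : Ω → ℝ} (hW : ExpBound μ W) (h : ∀ ω, V ω ≤ W ω) : ExpBound μ V :=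
  (lintegral_mono fun ω => ENNReal.ofReal_le_ofReal (Real.exp_le_exp.2 (h ω))).trans hW

lemma ExpBound.mgf_one_le [IsProbabilityMeasure μ] {V : Ω → ℝ} (hV : Measurable V) (h : ExpBound μ V) :
    Integrable (fun ω => Real.exp (1 * V ω)) μ ∧ mgf V μ 1 ≤ 2 := by
  simp only [mgf, one_mul]
  refine ⟨integrable_of_lintegral_ofReal_ne_top (by fun_prop) (fun ω => (Real.exp_pos _).le)
    (h.trans_lt (by simp)).ne,
    integral_le_of_lintegral_ofReal_le (by fun_prop) (fun ω => (Real.exp_pos _).le) (by simp) ?_⟩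
  simpa [ExpBound] using h

lemma ExpBound.integrable [IsProbabilityMeasure μ] {V : Ω → ℝ} (hV : Measurable V) (h0 : ∀ ω, 0 ≤ V ω)
    (h : ExpBound μ V) : Integrable V μ ∧ ∫ ω, V ω ∂μ ≤ 1 := by
  obtain ⟨h1, h2⟩ := h.mgf_one_le hV
  have hI : Integrable V μ := by
    refine h1.mono' hV.aestronglyMeasurable (Filter.Eventually.of_forall fun ω => ?_)
    rw [Real.norm_of_nonneg (h0 ω)]
    have := Real.add_one_le_exp (1 * V ω)
    linarith
  refine ⟨hI, ?_⟩
  have h3 : ∫ ω, (V ω + 1) ∂μ ≤ mgf V μ 1 :=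
    integral_mono (hI.add (integrable_const 1)) h1 fun ω => by
      have := Real.add_one_le_exp (1 * V ω)
      simp only; linarith
  rw [integral_add hI (integrable_const 1)] at h3
  simp at h3
  linarith

lemma measure_sum_ge_le_of_expBound [IsProbabilityMeasure μ] {ι : Type*} [Fintype ι]
    {V : ι → Ω → ℝ}
    (hV : ∀ i, Measurable (V i)) (hind : iIndepFun V μ) (h : ∀ i, ExpBound μ (V i)) (s : ℝ) :
    μ {ω | s ≤ ∑ i, V i ω} ≤ ENNReal.ofReal (Real.exp (-s) * 2 ^ Fintype.card ι) := by
  have key := measure_ge_le_exp_mul_mgf (μ := μ) (X := ∑ i, V i) s zero_le_one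
    (hind.integrable_exp_mul_sum hV fun i _ => ((h i).mgf_one_le (hV i)).1)
  rw [hind.mgf_sum hV] at key
  simp only [Finset.sum_apply, neg_mul, one_mul] at key
  refine measure_le_ofReal_of_real_le (key.trans ?_)
  gcongr
  exact (Finset.prod_le_prod (fun i _ => mgf_nonneg)
    fun i _ => ((h i).mgf_one_le (hV i)).2).trans (by simp)

/-- The Gaussian range of a subexponential variable: as long as `t * B ≤ 1`, the remainder is
quadratic in `t`. -/
lemma lintegral_expRem_le_of_expBound {Y : Ω → ℝ} {B t : ℝ} (hB : 0 < B) (ht : 0 ≤ t)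
    (htB : t * B ≤ 1) (h : ExpBound μ fun ω => |Y ω| / B) :
    ∫⁻ ω, ENNReal.ofReal (expRem (t * |Y ω|)) ∂μ ≤ ENNReal.ofReal (2 * (t * B) ^ 2) := by
  have h1 : ∀ ω, ENNReal.ofReal (expRem (t * |Y ω|)) ≤
      ENNReal.ofReal ((t * B) ^ 2) * ENNReal.ofReal (Real.exp (|Y ω| / B)) := fun ω => by
    rw [← ENNReal.ofReal_mul (by positivity)]
    refine ENNReal.ofReal_le_ofReal ?_
    have h2 : t * |Y ω| = t * B * (|Y ω| / B) := by field_simp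
    rw [h2]
    refine (expRem_mul_le (by positivity) htB (by positivity)).trans ?_
    gcongr
    have : 0 ≤ |Y ω| / B := by positivity
    unfold expRem; linarith
  refine (lintegral_mono h1).trans ?_
  rw [lintegral_const_mul' _ _ ENNReal.ofReal_ne_top, mul_comm 2,
    ENNReal.ofReal_mul (by positivity)]
  gcongr
  simpa [ExpBound] using h

end Exponential

/-! ### The `ψ₂` norm -/

section PsiNorm

variable {Ω : Type*} [MeasurableSpace Ω] {μ : Measure Ω}

lemma lintegral_psi_two_le_one_iff [IsProbabilityMeasure μ] {Y : Ω → ℝ} {a : ℝ} :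
    ∫⁻ ω, ENNReal.ofReal (psi 2 (|Y ω| / a)) ∂μ ≤ 1 ↔ ExpBound μ fun ω => (Y ω / a) ^ 2 := by
  have h1 : ∀ ω, ENNReal.ofReal (Real.exp ((Y ω / a) ^ 2)) =
      ENNReal.ofReal (psi 2 (|Y ω| / a)) + 1 := fun ω => by
    have h2 : (|Y ω| / a) ^ (2 : ℝ) = (Y ω / a) ^ 2 := by
      rw [Real.rpow_two, div_pow, div_pow, sq_abs]
    have h3 := Real.add_one_le_exp ((Y ω / a) ^ 2)
    have h4 := sq_nonneg (Y ω / a)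
    rw [psi, h2, ← ENNReal.ofReal_one, ← ENNReal.ofReal_add (by linarith) zero_le_one]
    ring_nf
  rw [ExpBound]
  simp_rw [h1]
  rw [lintegral_add_right _ measurable_const]
  simp only [lintegral_const, measure_univ, mul_one]
  rw [(one_add_one_eq_two : (1 + 1 : ℝ≥0∞) = 2).symm]
  exact (ENNReal.add_le_add_iff_right ENNReal.one_ne_top).symm

/-- The strict inequality avoids asking whether the infimum is attained. It is the reason why the
later estimates use parameters strictly above the norms. -/
lemma expBound_of_psiNorm_lt [IsProbabilityMeasure μ] {Y : Ω → ℝ} {a : ℝ}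
    (h : psiNorm 2 Y μ < ENNReal.ofReal a) : ExpBound μ fun ω => (Y ω / a) ^ 2 := by
  simp only [psiNorm, iInf_lt_iff] at h
  obtain ⟨c, hc, hc1, hca⟩ := h
  have hca' : c < a := (ENNReal.ofReal_lt_ofReal_iff_of_nonneg hc.le).1 hca
  refine (lintegral_psi_two_le_one_iff.1 hc1).mono fun ω => ?_
  rw [div_pow, div_pow]
  gcongr

lemma psiNorm_le_of_expBound [IsProbabilityMeasure μ] {Y : Ω → ℝ} {a : ℝ}
    (ha : 0 < a) (h : ExpBound μ fun ω => (Y ω / a) ^ 2) :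
    psiNorm 2 Y μ ≤ ENNReal.ofReal a :=
  iInf_le_of_le a (iInf_le_of_le ha (iInf_le _ (lintegral_psi_two_le_one_iff.2 h)))

lemma psiNorm_neg (Y : Ω → ℝ) : psiNorm 2 (fun ω => -Y ω) μ = psiNorm 2 Y μ := by
  simp [psiNorm]

lemma ExpBound.convex_comb {V W : Ω → ℝ} (hV : ExpBound μ V) (hW : ExpBound μ W)
    (hVm : Measurable V) {p q : ℝ} (hp : 0 ≤ p) (hq : 0 ≤ q) (hpq : p + q = 1) :
    ExpBound μ fun ω => p * V ω + q * W ω := by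
  have h1 : ∀ ω, ENNReal.ofReal (Real.exp (p * V ω + q * W ω)) ≤
      ENNReal.ofReal p * ENNReal.ofReal (Real.exp (V ω)) +
        ENNReal.ofReal q * ENNReal.ofReal (Real.exp (W ω)) := fun ω => by
    rw [← ENNReal.ofReal_mul hp, ← ENNReal.ofReal_mul hq,
      ← ENNReal.ofReal_add (by positivity) (by positivity)]
    exact ENNReal.ofReal_le_ofReal
      (convexOn_exp.2 (Set.mem_univ _) (Set.mem_univ _) hp hq hpq)
  refine (lintegral_mono h1).trans ?_
  rw [lintegral_add_left (by fun_prop), lintegral_const_mul' _ _ ENNReal.ofReal_ne_top,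
    lintegral_const_mul' _ _ ENNReal.ofReal_ne_top]
  calc _ ≤ ENNReal.ofReal p * 2 + ENNReal.ofReal q * 2 := by
        gcongr
        exacts [hV, hW]
    _ = 2 := by
        rw [← add_mul, ← ENNReal.ofReal_add hp hq, hpq]; simp

/-- The square of `(Y - Z) / (a + b)` is at most the convex combination of `(Y / a)²` and `(Z / b)²`
with weights `a / (a + b)` and `b / (a + b)`; convexity of `exp` does the rest. -/
lemma psiNorm_sub_le [IsProbabilityMeasure μ] {Y Z : Ω → ℝ} (hY : Measurable Y) :
    psiNorm 2 (fun ω => Y ω - Z ω) μ ≤ psiNorm 2 Y μ + psiNorm 2 Z μ := by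
  refine ENNReal.le_of_forall_pos_le_add fun ε hε hfin => ?_
  obtain ⟨hYf, hZf⟩ := ENNReal.add_lt_top.1 hfin
  have hε' : (0 : ℝ) < ε / 2 := by positivity
  set a := (psiNorm 2 Y μ).toReal + ε / 2 with ha
  set b := (psiNorm 2 Z μ).toReal + ε / 2 with hb
  have ha0 : 0 < a := by positivity
  have hb0 : 0 < b := by positivity
  have h1 : psiNorm 2 Y μ < ENNReal.ofReal a :=
    (ENNReal.lt_ofReal_iff_toReal_lt hYf.ne).2 (by linarith)
  have h2 : psiNorm 2 Z μ < ENNReal.ofReal b :=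
    (ENNReal.lt_ofReal_iff_toReal_lt hZf.ne).2 (by linarith)
  have h3 := (expBound_of_psiNorm_lt h1).convex_comb (expBound_of_psiNorm_lt h2)
    (by fun_prop) (p := a / (a + b)) (q := b / (a + b)) (by positivity) (by positivity)
    (by field_simp)
  refine (psiNorm_le_of_expBound (a := a + b) (by positivity)
    (h3.mono fun ω => ?_)).trans ?_
  · have h4 : a / (a + b) * (Y ω / a) ^ 2 + b / (a + b) * (Z ω / b) ^ 2
        - ((Y ω - Z ω) / (a + b)) ^ 2 = (b * Y ω + a * Z ω) ^ 2 / (a * b * (a + b) ^ 2) := by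
      field_simp; ring
    have h5 : 0 ≤ (b * Y ω + a * Z ω) ^ 2 / (a * b * (a + b) ^ 2) := by positivity
    linarith
  · have h6 : a + b = (psiNorm 2 Y μ).toReal + (psiNorm 2 Z μ).toReal + ε := by
      rw [ha, hb]; ring
    rw [h6, ENNReal.ofReal_add (by positivity) (by positivity),
      ENNReal.ofReal_add (by positivity) (by positivity), ENNReal.ofReal_toReal hYf.ne,
      ENNReal.ofReal_toReal hZf.ne, ENNReal.ofReal_coe_nnreal]

lemma psiNorm_zero [IsProbabilityMeasure μ] : psiNorm 2 (fun _ : Ω => (0 : ℝ)) μ = 0 := by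
  refine le_antisymm (ENNReal.le_of_forall_pos_le_add fun ε hε _ => ?_) (by simp)
  refine (psiNorm_le_of_expBound (a := ε) (by positivity) ?_).trans (by simp)
  simp [ExpBound]

/-- By convexity `exp(θ s) ≤ θ exp s + 1` for `0 ≤ θ ≤ 1`, so shrinking the exponent by a small `θ`
brings any finite exponential moment below 2. -/
lemma psiNorm_lt_top_of_lintegral_exp [IsProbabilityMeasure μ] {Y : Ω → ℝ}
    {t : ℝ} (ht : 0 < t) (h : ∫⁻ ω, ENNReal.ofReal (Real.exp (t * Y ω ^ 2)) ∂μ ≠ ∞) :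
    psiNorm 2 Y μ < ∞ := by
  set M := (∫⁻ ω, ENNReal.ofReal (Real.exp (t * Y ω ^ 2)) ∂μ).toReal with hM
  have hM0 : 0 ≤ M := ENNReal.toReal_nonneg
  set θ := (M + 1)⁻¹ with hθ
  have hθ0 : 0 < θ := by positivity
  have hθ1 : θ ≤ 1 := inv_le_one_of_one_le₀ (by linarith)
  have hθM : θ * M ≤ 1 := by
    rw [hθ, inv_mul_le_iff₀ (by positivity)]; linarith
  refine (psiNorm_le_of_expBound (a := 1 / Real.sqrt (θ * t)) (by positivity) ?_).trans_lt
    ENNReal.ofReal_lt_top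
  have h1 : ∀ ω, ENNReal.ofReal (Real.exp ((Y ω / (1 / Real.sqrt (θ * t))) ^ 2)) ≤
      ENNReal.ofReal θ * ENNReal.ofReal (Real.exp (t * Y ω ^ 2)) + 1 := fun ω => by
    rw [← ENNReal.ofReal_mul hθ0.le, ← ENNReal.ofReal_one,
      ← ENNReal.ofReal_add (by positivity) zero_le_one]
    refine ENNReal.ofReal_le_ofReal ?_
    have h2 : (Y ω / (1 / Real.sqrt (θ * t))) ^ 2 = θ * (t * Y ω ^ 2) + (1 - θ) * 0 := by
      rw [div_pow, div_pow, Real.sq_sqrt (by positivity)]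
      field_simp; ring
    rw [h2]
    refine (convexOn_exp.2 (Set.mem_univ (t * Y ω ^ 2)) (Set.mem_univ 0) hθ0.le
      (by linarith : 0 ≤ 1 - θ) (by ring)).trans ?_
    simp only [smul_eq_mul, Real.exp_zero, mul_one]
    linarith
  refine (lintegral_mono h1).trans ?_
  rw [lintegral_add_right _ measurable_const, lintegral_const_mul' _ _ ENNReal.ofReal_ne_top,
    ← ENNReal.ofReal_toReal h, ← ENNReal.ofReal_mul hθ0.le]
  simp only [lintegral_const, measure_univ, mul_one]
  rw [(one_add_one_eq_two : (1 + 1 : ℝ≥0∞) = 2).symm]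
  exact add_le_add (by simpa using ENNReal.ofReal_le_ofReal hθM) le_rfl

end PsiNorm

/-! ### Consequences of the Bernstein moment condition -/

section Bernstein

variable {Ω Θ : Type*} [MeasurableSpace Ω] {μ : Measure Ω} {m : ℕ}
  {X : Fin m → Ω → Θ} {F : Set (Θ → ℝ)} {σ K : ℝ}

lemma lintegral_ofReal_expRem_eq_tsum {Y : Ω → ℝ} (hY : Measurable Y) {t : ℝ} (ht : 0 ≤ t) :
    ∫⁻ ω, ENNReal.ofReal (expRem (t * |Y ω|)) ∂μ = ∑' q : ℕ,
      ENNReal.ofReal (t ^ (q + 2) / ((q + 2)! : ℝ)) *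
        ∫⁻ ω, ENNReal.ofReal (|Y ω| ^ (q + 2)) ∂μ := by
  have h1 : ∀ ω, ENNReal.ofReal (expRem (t * |Y ω|)) = ∑' q : ℕ,
      ENNReal.ofReal (t ^ (q + 2) / ((q + 2)! : ℝ)) * ENNReal.ofReal (|Y ω| ^ (q + 2)) :=
    fun ω => by
      rw [← (hasSum_expRem _).tsum_eq, ENNReal.ofReal_tsum_of_nonneg
        (fun q => by positivity) (hasSum_expRem _).summable]
      congr 1; ext q
      rw [← ENNReal.ofReal_mul (by positivity), mul_pow]
      ring_nf
  simp_rw [h1]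
  rw [lintegral_tsum fun q => by fun_prop]
  congr 1; ext q
  rw [lintegral_const_mul' _ _ ENNReal.ofReal_ne_top]

lemma BernsteinMoments.sum_lintegral_le (hm : 1 ≤ m) (hB : BernsteinMoments X μ F σ K)
    {f : Θ → ℝ} (hf : f ∈ F) {q : ℕ} (hq : 2 ≤ q) :
    ∑ i, ∫⁻ ω, ENNReal.ofReal (|f (X i ω) ^ 2 - ∫ ω', f (X i ω') ^ 2 ∂μ| ^ q) ∂μ ≤
      ENNReal.ofReal (m * ((q ! : ℝ) / 2 * σ ^ 2 * K ^ (q - 2))) := by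
  have h := hB f hf q hq
  have hm0 : (m : ℝ≥0∞) ≠ 0 := by simp; omega
  rw [ENNReal.ofReal_mul (by positivity), ENNReal.ofReal_natCast]
  calc _ = (m : ℝ≥0∞) * ((1 / (m : ℝ≥0∞)) * ∑ i, ∫⁻ ω, ENNReal.ofReal
        (|f (X i ω) ^ 2 - ∫ ω', f (X i ω') ^ 2 ∂μ| ^ q) ∂μ) := by
        rw [← mul_assoc, one_div, ENNReal.mul_inv_cancel hm0 (by simp), one_mul]
    _ ≤ _ := by gcongr

variable [MeasurableSpace Θ]

/-- The factorials cancel against the exponential series, leaving a geometric series of ratio `t * K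
≤ 1 / 2`. -/
lemma BernsteinMoments.sum_lintegral_expRem_le (hm : 1 ≤ m) (hB : BernsteinMoments X μ F σ K)
    (hX : ∀ i, Measurable (X i)) (hK : 0 < K) {f : Θ → ℝ} (hf : f ∈ F) (hfm : Measurable f)
    {t : ℝ} (ht : 0 ≤ t) (htK : t * K ≤ 1 / 2) :
    ∑ i, ∫⁻ ω, ENNReal.ofReal (expRem (t * |f (X i ω) ^ 2 - ∫ ω', f (X i ω') ^ 2 ∂μ|)) ∂μ ≤
      ENNReal.ofReal (m * t ^ 2 * σ ^ 2) := by
  have hmeas : ∀ i, Measurable fun ω => f (X i ω) ^ 2 - ∫ ω', f (X i ω') ^ 2 ∂μ :=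
    fun i => by have := hX i; fun_prop
  simp_rw [fun i => lintegral_ofReal_expRem_eq_tsum (μ := μ) (hmeas i) ht]
  rw [← Summable.tsum_finsetSum fun i _ => ENNReal.summable]
  simp_rw [← Finset.mul_sum]
  have hg : HasSum (fun q : ℕ => m * t ^ 2 * σ ^ 2 / 2 * (1 / 2 : ℝ) ^ q) (m * t ^ 2 * σ ^ 2) := by
    have := hasSum_geometric_two.mul_left (m * t ^ 2 * σ ^ 2 / 2)
    rwa [div_mul_cancel₀ _ (two_ne_zero)] at this
  rw [← hg.tsum_eq, ENNReal.ofReal_tsum_of_nonneg (fun q => by positivity) hg.summable]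
  refine ENNReal.tsum_le_tsum fun q => ?_
  refine (mul_le_mul_right (hB.sum_lintegral_le hm hf (by omega)) _).trans ?_
  rw [← ENNReal.ofReal_mul (by positivity)]
  refine ENNReal.ofReal_le_ofReal ?_
  have h1 : t ^ (q + 2) / ((q + 2)! : ℝ) * (m * (((q + 2)! : ℝ) / 2 * σ ^ 2 * K ^ (q + 2 - 2))) =
      m * t ^ 2 * σ ^ 2 / 2 * (t * K) ^ q := by
    have : ((q + 2)! : ℝ) ≠ 0 := by positivity
    rw [Nat.add_sub_cancel, pow_add, mul_pow]
    field_simp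
  rw [h1]
  gcongr

lemma BernsteinMoments.integrable_sq [IsProbabilityMeasure μ] (hm : 1 ≤ m)
    (hB : BernsteinMoments X μ F σ K) (hX : ∀ i, Measurable (X i)) {f : Θ → ℝ} (hf : f ∈ F)
    (hfm : Measurable f) (i : Fin m) : Integrable (fun ω => f (X i ω) ^ 2) μ := by
  set c := ∫ ω', f (X i ω') ^ 2 ∂μ
  have hmeas : Measurable fun ω => f (X i ω) ^ 2 - c := by have := hX i; fun_prop
  have h1 : ∫⁻ ω, ENNReal.ofReal (|f (X i ω) ^ 2 - c| ^ 2) ∂μ ≠ ∞ :=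
    ((Finset.single_le_sum (f := fun i => ∫⁻ ω, ENNReal.ofReal
      (|f (X i ω) ^ 2 - ∫ ω', f (X i ω') ^ 2 ∂μ| ^ 2) ∂μ) (fun i _ => zero_le)
      (Finset.mem_univ i)).trans_lt
      ((hB.sum_lintegral_le hm hf le_rfl).trans_lt ENNReal.ofReal_lt_top)).ne
  have h2 : Integrable (fun ω => |f (X i ω) ^ 2 - c| ^ 2) μ :=
    integrable_of_lintegral_ofReal_ne_top (by fun_prop) (fun ω => by positivity) h1
  have h3 : Integrable (fun ω => f (X i ω) ^ 2 - c) μ := by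
    refine (h2.add (integrable_const (1 : ℝ))).mono' hmeas.aestronglyMeasurable
      (Filter.Eventually.of_forall fun ω => ?_)
    simp only [Real.norm_eq_abs, Pi.add_apply]
    nlinarith [sq_nonneg (|f (X i ω) ^ 2 - c| - 1)]
  exact (h3.add (integrable_const c)).congr
    (Filter.Eventually.of_forall fun ω => sub_add_cancel _ _)

/-- The moment condition gives `f²(X i)` a finite exponential moment, at `t = 1 / (2K)`. -/
lemma BernsteinMoments.psiNorm_lt_top [IsProbabilityMeasure μ] (hm : 1 ≤ m)
    (hB : BernsteinMoments X μ F σ K) (hX : ∀ i, Measurable (X i)) (hK : 0 < K) {f : Θ → ℝ}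
    (hf : f ∈ F) (hfm : Measurable f) (i : Fin m) : psiNorm 2 (fun ω => f (X i ω)) μ < ∞ := by
  set t := 1 / (2 * K) with ht
  have ht0 : 0 < t := by positivity
  have htK : t * K ≤ 1 / 2 := by rw [ht]; field_simp; exact le_rfl
  set c := ∫ ω', f (X i ω') ^ 2 ∂μ
  have h1 : ∫⁻ ω, ENNReal.ofReal (expRem (t * |f (X i ω) ^ 2 - c|)) ∂μ ≠ ∞ :=
    ((Finset.single_le_sum (f := fun i => ∫⁻ ω, ENNReal.ofReal
      (expRem (t * |f (X i ω) ^ 2 - ∫ ω', f (X i ω') ^ 2 ∂μ|)) ∂μ) (fun i _ => zero_le)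
      (Finset.mem_univ i)).trans_lt
      ((hB.sum_lintegral_expRem_le hm hX hK hf hfm ht0.le htK).trans_lt ENNReal.ofReal_lt_top)).ne
  refine psiNorm_lt_top_of_lintegral_exp ht0 (ne_of_lt ?_)
  have h2 : ∀ ω, ENNReal.ofReal (Real.exp (t * f (X i ω) ^ 2)) ≤
      ENNReal.ofReal (Real.exp (t * |c|) * 2) *
        (ENNReal.ofReal (expRem (t * |f (X i ω) ^ 2 - c|)) + 1) := fun ω => by
    rw [← ENNReal.ofReal_one, ← ENNReal.ofReal_add (expRem_nonneg _) zero_le_one,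
      ← ENNReal.ofReal_mul (by positivity)]
    refine ENNReal.ofReal_le_ofReal ?_
    rw [mul_assoc]
    refine le_trans ?_ (mul_le_mul_of_nonneg_left
      (exp_le_two_mul_expRem_add_one (by positivity)) (Real.exp_pos _).le)
    rw [← Real.exp_add, ← mul_add]
    gcongr
    have h3 := le_abs_self (f (X i ω) ^ 2 - c)
    have h4 := le_abs_self c
    linarith
  refine (lintegral_mono h2).trans_lt ?_
  rw [lintegral_const_mul' _ _ ENNReal.ofReal_ne_top, lintegral_add_right _ measurable_const]
  simp only [lintegral_const, measure_univ, mul_one]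
  exact ENNReal.mul_lt_top ENNReal.ofReal_lt_top
    (ENNReal.add_lt_top.2 ⟨lt_top_iff_ne_top.2 h1, ENNReal.one_lt_top⟩)

/-- Bernstein's inequality for a single function. -/
lemma BernsteinMoments.measure_avgSquares_ge_le [IsProbabilityMeasure μ] (hm : 1 ≤ m)
    (hB : BernsteinMoments X μ F σ K) (hX : ∀ i, Measurable (X i)) (hind : iIndepFun X μ)
    (hσ : 0 < σ) (hK : 0 < K) {f : Θ → ℝ} (hf : f ∈ F) (hfm : Measurable f) {u : ℝ}
    (hu : 0 < u) :
    μ {ω | 10 * (Real.sqrt u * (σ / Real.sqrt m) + u * (K / m)) ≤ avgSquares X μ f ω} ≤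
      ENNReal.ofReal (2 * Real.exp (-4 * u)) := by
  have hm0 : (0 : ℝ) < m := by exact_mod_cast hm
  set s := 10 * (Real.sqrt u * (σ / Real.sqrt m) + u * (K / m)) with hs
  have hsm : s * m = 10 * (Real.sqrt u * σ * Real.sqrt m + u * K) := by
    have : (m : ℝ) = Real.sqrt m * Real.sqrt m := (Real.mul_self_sqrt hm0.le).symm
    have h2 : σ / Real.sqrt m * m = σ * Real.sqrt m := by
      nth_rewrite 2 [this]; field_simp
    rw [hs]
    calc _ = 10 * (Real.sqrt u * (σ / Real.sqrt m * m) + u * (K / m * m)) := by ring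
      _ = _ := by rw [h2, div_mul_cancel₀ _ hm0.ne']; ring
  have hint := fun i => hB.integrable_sq hm hX hf hfm i
  have hzero : ∀ i, ∫ ω, (f (X i ω) ^ 2 - ∫ ω', f (X i ω') ^ 2 ∂μ) ∂μ = 0 := fun i => by
    rw [integral_sub (hint i) (integrable_const _)]; simp
  obtain ⟨t, ht0, htK, ht⟩ : ∃ t : ℝ, 0 ≤ t ∧ t * K ≤ 1 / 2 ∧
      -t * (s * m) + m * t ^ 2 * σ ^ 2 ≤ -4 * u := by
    have hsu : Real.sqrt u ^ 2 = u := Real.sq_sqrt hu.le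
    have hsm' : Real.sqrt m ^ 2 = m := Real.sq_sqrt hm0.le
    have hsu0 : 0 < Real.sqrt u := Real.sqrt_pos.2 hu
    have hsm0 : 0 < Real.sqrt m := Real.sqrt_pos.2 hm0
    set v := Real.sqrt u
    set w := Real.sqrt m
    rw [hsm, ← hsu, ← hsm']
    -- The Gaussian choice of `t`, of order `√u / (√m σ)`, is capped at `1 / (2K)`, where the
    -- remainder estimate stops being available.
    rcases le_total (v / (w * σ)) (1 / (2 * K)) with h | h
    · refine ⟨v / (w * σ), by positivity, ?_, ?_⟩
      · calc _ ≤ 1 / (2 * K) * K := by gcongr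
          _ = 1 / 2 := by field_simp
      · have h1 : -(v / (w * σ)) * (10 * (v * σ * w + v ^ 2 * K)) +
            w ^ 2 * (v / (w * σ)) ^ 2 * σ ^ 2 = -9 * v ^ 2 - 10 * (v ^ 3 * K / (w * σ)) := by
          field_simp; ring
        have h2 : 0 ≤ v ^ 3 * K / (w * σ) := by positivity
        rw [h1]; nlinarith
    · refine ⟨1 / (2 * K), by positivity, (by field_simp; exact le_rfl), ?_⟩
      have h1 : w ^ 2 * (1 / (2 * K)) ^ 2 * σ ^ 2 ≤ v ^ 2 := by
        have h2 : w * σ * (1 / (2 * K)) ≤ v := by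
          calc _ ≤ w * σ * (v / (w * σ)) := by gcongr
            _ = v := by field_simp
        calc _ = (w * σ * (1 / (2 * K))) ^ 2 := by ring
          _ ≤ v ^ 2 := by gcongr
      have h3 : -(1 / (2 * K)) * (10 * (v * σ * w + v ^ 2 * K)) =
          -5 * v ^ 2 - 5 * (v * σ * w / K) := by
        field_simp; ring
      have h4 : 0 ≤ v * σ * w / K := by positivity
      linarith
  have key := measure_abs_sum_sub_integral_ge_le (μ := μ)
    (Y := fun i ω => f (X i ω) ^ 2 - ∫ ω', f (X i ω') ^ 2 ∂μ)
    (fun i => by have := hX i; fun_prop)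
    (hind.comp (fun i x => f x ^ 2 - ∫ ω', f (X i ω') ^ 2 ∂μ) fun i => by fun_prop)
    (fun i => (hint i).sub (integrable_const _)) ht0 (by positivity)
    (hB.sum_lintegral_expRem_le hm hX hK hf hfm ht0 htK) (s * m)
  simp only [hzero, sub_zero] at key
  refine (measure_mono fun ω hω => ?_).trans (key.trans ?_)
  · simp only [Set.mem_ofPred_eq, avgSquares, abs_mul, abs_of_pos (one_div_pos.2 hm0)] at hω ⊢
    rwa [one_div, inv_mul_eq_div, le_div_iff₀ hm0] at hω
  · refine ENNReal.ofReal_le_ofReal ?_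
    gcongr

end Bernstein

/-! ### Deterministic chaining -/

section Deterministic

lemma sqrt_sum_sq_sub_le {ι : Type*} [Fintype ι] (v : ℕ → ι → ℝ) (b : ℕ → ℝ) {k N : ℕ}
    (hkN : k ≤ N) (h : ∀ n, k ≤ n → n < N → Real.sqrt (∑ i, (v (n + 1) i - v n i) ^ 2) ≤ b n) :
    Real.sqrt (∑ i, (v N i - v k i) ^ 2) ≤ ∑ n ∈ Finset.Ico k N, b n := by
  have h1 : ∀ x y : ι → ℝ, dist (WithLp.toLp 2 x : EuclideanSpace ℝ ι) (WithLp.toLp 2 y) =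
      Real.sqrt (∑ i, (y i - x i) ^ 2) := fun x y => by
    rw [dist_comm, EuclideanSpace.dist_eq]
    simp [Real.dist_eq, sq_abs]
  rw [← h1]
  refine dist_le_Ico_sum_of_dist_le (f := fun n => (WithLp.toLp 2 (v n) : EuclideanSpace ℝ ι))
    hkN fun hk hn => ?_
  rw [h1]
  exact h _ hk hn

/-- The chaining argument along a single chain. -/
lemma chain_bound {m : ℕ} (hm : 1 ≤ m) {l N : ℕ} (hlN : l ≤ N) (hmN : m ≤ 2 ^ N)
    (v e : ℕ → Fin m → ℝ) (r : ℕ → ℝ) {Δ γ W : ℝ} (hΔ : 0 ≤ Δ) (hr : ∀ n, 0 ≤ r n)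
    (hγ : ∑ n ∈ Finset.range N, Real.sqrt (2 ^ n) * r n ≤ γ)
    (hl : |(1 / (m : ℝ)) * ∑ i, (v l i ^ 2 - e l i)| ≤ W)
    (hsmall : ∀ n, l ≤ n → n < N → 2 ^ n < m →
      |∑ i, (v (n + 1) i ^ 2 - v n i ^ 2 - (e (n + 1) i - e n i))| ≤
        22 * Δ * r n * Real.sqrt (2 ^ n) * Real.sqrt m)
    (hlarge : ∀ n, l ≤ n → n < N → m ≤ 2 ^ n →
      ∑ i, (v (n + 1) i - v n i) ^ 2 ≤ 16 * 2 ^ n * r n ^ 2)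
    (he : ∀ n i, e n i ≤ Δ ^ 2) (hee : ∀ n i, |e (n + 1) i - e n i| ≤ 2 * Δ * r n) :
    |(1 / (m : ℝ)) * ∑ i, (v N i ^ 2 - e N i)| ≤
      2 * W + 60 * (γ ^ 2 / m + Δ / Real.sqrt m * γ) := by
  have hm0 : (0 : ℝ) < m := by exact_mod_cast hm
  set w := Real.sqrt m with hw
  have hw0 : 0 < w := Real.sqrt_pos.2 hm0
  have hw2 : (m : ℝ) = w ^ 2 := (Real.sq_sqrt hm0.le).symm
  -- The level where the regimes meet: from `k` on `m ≤ 2^n`, and between `l` and `k` the opposite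
  -- holds. If `m ≤ 2^l`, the lower part is empty.
  set k := max l (Nat.clog 2 m) with hk
  have hlk : l ≤ k := le_max_left _ _
  have hkN : k ≤ N := max_le hlN ((Nat.clog_le_iff_le_pow one_lt_two).2 hmN)
  have hmk : ∀ n, k ≤ n → m ≤ 2 ^ n := fun n hn =>
    (Nat.clog_le_iff_le_pow one_lt_two).1 ((le_max_right _ _).trans hn)
  have hkm : ∀ n, l ≤ n → n < k → 2 ^ n < m := fun n hn hnk => by
    by_contra! h
    have := (Nat.clog_le_iff_le_pow one_lt_two).2 h
    omega
  set b : ℕ → ℝ := fun n => Real.sqrt (2 ^ n) * r n with hb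
  have hb0 : ∀ n, 0 ≤ b n := fun n => mul_nonneg (Real.sqrt_nonneg _) (hr n)
  have hγ1 : ∀ p q, q ≤ N → ∑ n ∈ Finset.Ico p q, b n ≤ γ := fun p q hq =>
    (Finset.sum_le_sum_of_subset_of_nonneg (fun n hn => by
      simp only [Finset.mem_Ico, Finset.mem_range] at hn ⊢; omega) fun n _ _ => hb0 n).trans hγ
  have hγ0 : 0 ≤ γ := (Finset.sum_nonneg fun n _ => hb0 n).trans hγ
  set z : ℕ → ℝ := fun n => ∑ i, (v n i ^ 2 - e n i) with hz
  have habs : ∀ n, |(1 / (m : ℝ)) * z n| = |z n| / m := fun n => by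
    rw [abs_mul, abs_of_pos (one_div_pos.2 hm0)]; ring
  -- the levels below `k`
  have hzk : |z k - z l| ≤ 22 * Δ * w * γ := by
    have h1 := dist_le_Ico_sum_of_dist_le (f := z) (d := fun n => 22 * Δ * w * b n) hlk
      fun {n} hn hnk => by
        have h2 := hsmall n hn (by omega) (hkm n hn hnk)
        rw [Real.dist_eq, abs_sub_comm]
        have h3 : z (n + 1) - z n =
            ∑ i, (v (n + 1) i ^ 2 - v n i ^ 2 - (e (n + 1) i - e n i)) := by
          rw [hz, ← Finset.sum_sub_distrib]
          refine Finset.sum_congr rfl fun i _ => by ring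
        rw [h3]
        exact h2.trans (le_of_eq (by rw [hb]; ring))
    rw [← Finset.mul_sum, Real.dist_eq, abs_sub_comm] at h1
    exact h1.trans (mul_le_mul_of_nonneg_left (hγ1 l k hkN) (by positivity))
  -- the levels above `k`
  set S := Real.sqrt (∑ i, (v N i - v k i) ^ 2) with hS
  have hSγ : S ≤ 4 * γ := by
    have h1 := sqrt_sum_sq_sub_le v (fun n => 4 * b n) hkN fun n hn hnN => by
      refine Real.sqrt_le_iff.2 ⟨mul_nonneg (by norm_num) (hb0 n), ?_⟩
      refine (hlarge n (hlk.trans hn) hnN (hmk n hn)).trans (le_of_eq ?_)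
      rw [hb, mul_pow, mul_pow, Real.sq_sqrt (by positivity)]
      ring
    rw [← Finset.mul_sum] at h1
    exact h1.trans (mul_le_mul_of_nonneg_left (hγ1 k N le_rfl) (by norm_num))
  have hS0 : 0 ≤ S := Real.sqrt_nonneg _
  set Q := Real.sqrt (∑ i, v k i ^ 2) with hQ
  have hQ0 : 0 ≤ Q := Real.sqrt_nonneg _
  have hS2 : S ^ 2 = ∑ i, (v N i - v k i) ^ 2 := Real.sq_sqrt (by positivity)
  have hQ2 : Q ^ 2 = ∑ i, v k i ^ 2 := Real.sq_sqrt (by positivity)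
  have hQle : Q ^ 2 ≤ m * Δ ^ 2 + |z k| := by
    have h1 : ∑ i, v k i ^ 2 = z k + ∑ i, e k i := by
      rw [hz, ← Finset.sum_add_distrib]
      refine Finset.sum_congr rfl fun i _ => by ring
    have h2 : ∑ i, e k i ≤ m * Δ ^ 2 := by
      refine (Finset.sum_le_sum fun i _ => he k i).trans (le_of_eq ?_)
      simp
    have := le_abs_self (z k)
    rw [hQ2, h1]; linarith
  have hcross : |∑ i, (v N i - v k i) * v k i| ≤ S * Q := by
    rw [hS, hQ, ← Real.sqrt_mul (by positivity)]
    exact Real.abs_le_sqrt (Finset.sum_mul_sq_le_sq_mul_sq _ _ _)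
  have hsq : |∑ i, (v N i ^ 2 - v k i ^ 2)| ≤ S ^ 2 + 2 * (S * Q) := by
    have h1 : ∑ i, (v N i ^ 2 - v k i ^ 2) =
        S ^ 2 + 2 * ∑ i, (v N i - v k i) * v k i := by
      rw [hS2, Finset.mul_sum, ← Finset.sum_add_distrib]
      refine Finset.sum_congr rfl fun i _ => by ring
    rw [h1]
    refine (abs_add_le _ _).trans ?_
    rw [abs_of_nonneg (sq_nonneg S), abs_mul, abs_two]
    gcongr
  have hEi : ∀ i, |e N i - e k i| ≤ 2 * Δ * (γ / w) := fun i => by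
    have h1 := dist_le_Ico_sum_of_dist_le (f := fun n => e n i)
      (d := fun n => 2 * Δ / w * b n) hkN fun {n} hn hnN => by
        rw [Real.dist_eq, abs_sub_comm]
        refine (hee n i).trans ?_
        have h2 : w ≤ Real.sqrt (2 ^ n) := Real.sqrt_le_sqrt (by exact_mod_cast hmk n hn)
        have h3 : 2 * Δ / w * b n = 2 * Δ * r n * (Real.sqrt (2 ^ n) / w) := by
          rw [hb]; ring
        rw [h3]
        have h4 : 1 ≤ Real.sqrt (2 ^ n) / w := (one_le_div hw0).2 h2
        have h5 : 0 ≤ 2 * Δ * r n := by have := hr n; positivity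
        nlinarith
    rw [← Finset.mul_sum, Real.dist_eq, abs_sub_comm] at h1
    refine h1.trans ((mul_le_mul_of_nonneg_left (hγ1 k N le_rfl) (by positivity)).trans
      (le_of_eq (by ring)))
  have hE : |∑ i, (e N i - e k i)| ≤ m * (2 * Δ * (γ / w)) := by
    refine (Finset.abs_sum_le_sum_abs _ _).trans
      ((Finset.sum_le_sum fun i _ => hEi i).trans (le_of_eq ?_))
    simp
  have hzN : |z N - z k| ≤ S ^ 2 + 2 * (S * Q) + m * (2 * Δ * (γ / w)) := by
    have h1 : z N - z k = ∑ i, (v N i ^ 2 - v k i ^ 2) - ∑ i, (e N i - e k i) := by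
      rw [hz, ← Finset.sum_sub_distrib, ← Finset.sum_sub_distrib]
      refine Finset.sum_congr rfl fun i _ => by ring
    rw [h1]
    exact (abs_sub _ _).trans (add_le_add hsq hE)
  -- With `R = √|z k|`, the cross term `8γR` is at most `R² + 16γ²`. The extra `|z k|` accounts for
  -- the factor 2 in front of `W`.
  have hSQ : 2 * (S * Q) ≤ |z k| + 16 * γ ^ 2 + 8 * Δ * w * γ := by
    have hR : Real.sqrt |z k| ^ 2 = |z k| := Real.sq_sqrt (abs_nonneg _)
    have hR0 := Real.sqrt_nonneg |z k|
    set R := Real.sqrt |z k|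
    have h1 : Q ≤ w * Δ + R := by
      refine le_of_abs_le (abs_le_of_sq_le_sq ?_ (by positivity))
      refine hQle.trans ?_
      rw [hw2, ← hR]
      have : 0 ≤ w * Δ * R := by positivity
      nlinarith
    have h2 : S * Q ≤ 4 * γ * (w * Δ + R) := by gcongr
    rw [← hR]
    nlinarith [sq_nonneg (R - 4 * γ)]
  have hSS : S ^ 2 ≤ 16 * γ ^ 2 := by
    calc S ^ 2 ≤ (4 * γ) ^ 2 := by gcongr
      _ = _ := by ring
  have hmw : (m : ℝ) * (2 * Δ * (γ / w)) = 2 * Δ * w * γ := by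
    rw [hw2]; field_simp
  have hfin : |z N| ≤ 2 * |z l| + 60 * (γ ^ 2 + Δ * w * γ) := by
    have h1 : |z N| ≤ |z N - z k| + |z k| := by
      simpa using abs_add_le (z N - z k) (z k)
    have h2 : |z k| ≤ |z k - z l| + |z l| := by
      simpa using abs_add_le (z k - z l) (z l)
    have h3 : 0 ≤ Δ * w * γ := by positivity
    have h4 := sq_nonneg γ
    linarith
  have hzl : |z l| / m ≤ W := by rw [← habs]; exact hl
  change |(1 / (m : ℝ)) * z N| ≤ _
  rw [habs]
  calc |z N| / m ≤ (2 * |z l| + 60 * (γ ^ 2 + Δ * w * γ)) / m := by gcongr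
    _ = 2 * (|z l| / m) + 60 * (γ ^ 2 / m + Δ * (w / m) * γ) := by ring
    _ = 2 * (|z l| / m) + 60 * (γ ^ 2 / m + Δ / w * γ) := by
        have : w / m = 1 / w := by rw [hw2]; field_simp
        rw [this]; ring
    _ ≤ _ := by gcongr

end Deterministic

/-! ### Tail bounds for one link of a chain -/

section Events

variable {Ω Θ : Type*} [MeasurableSpace Ω] [MeasurableSpace Θ] {μ : Measure Ω}
  {m : ℕ} {X : Fin m → Ω → Θ}

/-- Factor `f² - g² = (f - g)(f + g)`, use `ab ≤ (a² + b²) / 2`, and bound the square of the mean of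
`f / Δ` and `g / Δ` by the mean of their squares. -/
lemma expBound_sq_sub_sq {f g : Ω → ℝ} (hf : Measurable f) (hg : Measurable g) {Δ r : ℝ}
    (hΔ : 0 < Δ) (hr : 0 < r) (h1 : ExpBound μ fun ω => (f ω / Δ) ^ 2)
    (h2 : ExpBound μ fun ω => (g ω / Δ) ^ 2) (h3 : ExpBound μ fun ω => ((f ω - g ω) / r) ^ 2) :
    ExpBound μ fun ω => |f ω ^ 2 - g ω ^ 2| / (2 * Δ * r) := by
  have h4 := h3.convex_comb (h1.convex_comb h2 (by fun_prop) (p := 1 / 2) (q := 1 / 2)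
    (by norm_num) (by norm_num) (by norm_num)) (by fun_prop) (p := 1 / 2) (q := 1 / 2)
    (by norm_num) (by norm_num) (by norm_num)
  refine h4.mono fun ω => ?_
  set a := |f ω - g ω| / r with ha
  set b := |f ω + g ω| / (2 * Δ) with hb
  have h5 : |f ω ^ 2 - g ω ^ 2| / (2 * Δ * r) = a * b := by
    rw [sq_sub_sq, abs_mul, ha, hb]; field_simp
  have h6 : ((f ω - g ω) / r) ^ 2 = a ^ 2 := by rw [ha, div_pow, div_pow, sq_abs]
  have h7 : b ^ 2 ≤ 1 / 2 * (f ω / Δ) ^ 2 + 1 / 2 * (g ω / Δ) ^ 2 := by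
    have h8 : 1 / 2 * (f ω / Δ) ^ 2 + 1 / 2 * (g ω / Δ) ^ 2 - b ^ 2 =
        ((f ω - g ω) / (2 * Δ)) ^ 2 := by
      rw [hb, div_pow |f ω + g ω|, sq_abs]; field_simp; ring
    have := sq_nonneg ((f ω - g ω) / (2 * Δ))
    linarith
  rw [h5, h6]
  nlinarith [sq_nonneg (a - b)]

/-- The exceptional event for an increment of a chain: a Bernstein type bound on the increment of
the squares while `2 ^ n < m`, and a bound on the empirical `L²` distance afterwards. -/
def incrementEvent (X : Fin m → Ω → Θ) (μ : Measure Ω) (Δ r : ℝ) (n : ℕ) (f g : Θ → ℝ) : Set Ω :=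
  if 2 ^ n < m then
    {ω | 22 * Δ * r * Real.sqrt (2 ^ n) * Real.sqrt m ≤ |∑ i, (f (X i ω) ^ 2 - g (X i ω) ^ 2 -
      (∫ ω', f (X i ω') ^ 2 ∂μ - ∫ ω', g (X i ω') ^ 2 ∂μ))|}
  else {ω | 16 * 2 ^ n * r ^ 2 ≤ ∑ i, (f (X i ω) - g (X i ω)) ^ 2}

lemma integrable_sq_of_expBound [IsProbabilityMeasure μ] {f : Ω → ℝ} (hf : Measurable f) {Δ : ℝ} (hΔ : 0 < Δ)
    (h : ExpBound μ fun ω => (f ω / Δ) ^ 2) :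
    Integrable (fun ω => f ω ^ 2) μ ∧ ∫ ω, f ω ^ 2 ∂μ ≤ Δ ^ 2 := by
  obtain ⟨h1, h2⟩ := h.integrable (by fun_prop) fun ω => sq_nonneg _
  have heq : ∀ ω, f ω ^ 2 = Δ ^ 2 * (f ω / Δ) ^ 2 := fun ω => by field_simp
  simp_rw [fun ω => heq ω]
  refine ⟨h1.const_mul _, ?_⟩
  rw [integral_const_mul]
  nlinarith [sq_nonneg Δ]

lemma abs_integral_sq_sub_le [IsProbabilityMeasure μ] {f g : Ω → ℝ} (hf : Measurable f) (hg : Measurable g) {Δ r : ℝ}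
    (hΔ : 0 < Δ) (hr : 0 < r) (h1 : ExpBound μ fun ω => (f ω / Δ) ^ 2)
    (h2 : ExpBound μ fun ω => (g ω / Δ) ^ 2) (h3 : ExpBound μ fun ω => ((f ω - g ω) / r) ^ 2) :
    |∫ ω, f ω ^ 2 ∂μ - ∫ ω, g ω ^ 2 ∂μ| ≤ 2 * Δ * r := by
  rw [← integral_sub (integrable_sq_of_expBound hf hΔ h1).1 (integrable_sq_of_expBound hg hΔ h2).1]
  refine (abs_integral_le_integral_abs).trans ?_
  have h4 := ((expBound_sq_sub_sq hf hg hΔ hr h1 h2 h3).integrable (by fun_prop)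
    fun ω => by positivity).2
  rw [integral_div, div_le_one (by positivity)] at h4
  exact h4

lemma measure_incrementEvent_le [IsProbabilityMeasure μ] (hX : ∀ i, Measurable (X i)) (hind : iIndepFun X μ)
    {Δ r : ℝ} (hΔ : 0 < Δ) (hr : 0 < r) (n : ℕ) {f g : Θ → ℝ} (hf : Measurable f)
    (hg : Measurable g) (h1 : ∀ i, ExpBound μ fun ω => (f (X i ω) / Δ) ^ 2)
    (h2 : ∀ i, ExpBound μ fun ω => (g (X i ω) / Δ) ^ 2)
    (h3 : ∀ i, ExpBound μ fun ω => ((f (X i ω) - g (X i ω)) / r) ^ 2) :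
    μ (incrementEvent X μ Δ r n f g) ≤ ENNReal.ofReal (2 * Real.exp (-9 * 2 ^ n)) := by
  have hfX : ∀ i, Measurable fun ω => f (X i ω) := fun i => hf.comp (hX i)
  have hgX : ∀ i, Measurable fun ω => g (X i ω) := fun i => hg.comp (hX i)
  unfold incrementEvent
  split_ifs with hn
  · have hm0 : (0 : ℝ) < m := by exact_mod_cast (Nat.zero_le _).trans_lt hn
    have hnm : (2 : ℝ) ^ n ≤ m := by exact_mod_cast hn.le
    set w := Real.sqrt m with hw
    have hw0 : 0 < w := Real.sqrt_pos.2 hm0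
    have hw2 : (m : ℝ) = w ^ 2 := (Real.sq_sqrt hm0.le).symm
    set x := Real.sqrt (2 ^ n) with hx
    have hx0 : 0 < x := Real.sqrt_pos.2 (by positivity)
    have hx2 : (2 : ℝ) ^ n = x ^ 2 := (Real.sq_sqrt (by positivity)).symm
    have hxw : x ≤ w := Real.sqrt_le_sqrt hnm
    set B := 2 * Δ * r with hB
    have hB0 : 0 < B := by positivity
    -- Here `t * B = √(2^n / m)` is at most 1 because `2^n < m`. The exponent becomes `-11·2^n +
    -- 2·2^n = -9·2^n`.
    set t := x / (w * B) with ht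
    have ht0 : 0 ≤ t := by positivity
    have htB : t * B = x / w := by rw [ht]; field_simp
    have hint : ∀ i, Integrable (fun ω => f (X i ω) ^ 2 - g (X i ω) ^ 2) μ := fun i =>
      (integrable_sq_of_expBound (hfX i) hΔ (h1 i)).1.sub
        (integrable_sq_of_expBound (hgX i) hΔ (h2 i)).1
    have key := measure_abs_sum_sub_integral_ge_le (μ := μ)
      (Y := fun i ω => f (X i ω) ^ 2 - g (X i ω) ^ 2) (fun i => by have := hX i; fun_prop)
      (hind.comp (fun i x => f x ^ 2 - g x ^ 2) fun i => by fun_prop) hint ht0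
      (A := 2 * 2 ^ n) (by positivity) ?_ (22 * Δ * r * x * w)
    · have hI : ∀ i, ∫ ω, (f (X i ω) ^ 2 - g (X i ω) ^ 2) ∂μ =
          ∫ ω, f (X i ω) ^ 2 ∂μ - ∫ ω, g (X i ω) ^ 2 ∂μ := fun i =>
        integral_sub (integrable_sq_of_expBound (hfX i) hΔ (h1 i)).1
          (integrable_sq_of_expBound (hgX i) hΔ (h2 i)).1
      simp only [hI] at key
      refine key.trans (ENNReal.ofReal_le_ofReal ?_)
      gcongr
      have : t * (22 * Δ * r * x * w) = 11 * x ^ 2 := by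
        rw [ht, hB]; field_simp; norm_num
      rw [neg_mul, this, hx2]; linarith
    · refine (Finset.sum_le_sum fun i _ => lintegral_expRem_le_of_expBound hB0 ht0
        (by rw [htB]; exact (div_le_one hw0).2 hxw)
        (expBound_sq_sub_sq (hfX i) (hgX i) hΔ hr (h1 i) (h2 i) (h3 i))).trans (le_of_eq ?_)
      rw [Finset.sum_const, Finset.card_univ, Fintype.card_fin, nsmul_eq_mul,
        ← ENNReal.ofReal_natCast, ← ENNReal.ofReal_mul (by positivity), htB, hx2, hw2]
      congr 1; field_simp
  · have hmn : m ≤ 2 ^ n := not_lt.1 hn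
    have key := measure_sum_ge_le_of_expBound (μ := μ)
      (V := fun i ω => ((f (X i ω) - g (X i ω)) / r) ^ 2) (fun i => by have := hX i; fun_prop)
      (hind.comp (fun i x => ((f x - g x) / r) ^ 2) fun i => by fun_prop) h3 (16 * 2 ^ n)
    refine (measure_mono fun ω hω => ?_).trans (key.trans (ENNReal.ofReal_le_ofReal ?_))
    · simp only [Set.mem_ofPred_eq, div_pow] at hω ⊢
      rwa [← Finset.sum_div, le_div_iff₀ (by positivity)]
    · rw [Fintype.card_fin]
      -- The `m` factors 2 from the exponential moments are affordable because `m ≤ 2^n`.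
      have h4 : (2 : ℝ) ^ m ≤ Real.exp (2 ^ n) := by
        calc (2 : ℝ) ^ m ≤ (Real.exp 1) ^ m := by
              gcongr; have := Real.add_one_le_exp 1; linarith
          _ = Real.exp m := by rw [← Real.exp_nat_mul, mul_one]
          _ ≤ _ := Real.exp_le_exp.2 (by exact_mod_cast hmn)
      calc _ ≤ Real.exp (-(16 * 2 ^ n)) * Real.exp (2 ^ n) := by gcongr
        _ = Real.exp (-15 * 2 ^ n) := by rw [← Real.exp_add]; ring_nf
        _ ≤ Real.exp (-9 * 2 ^ n) := by gcongr; norm_num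
        _ ≤ _ := by have := Real.exp_pos (-9 * 2 ^ n); linarith

end Events

/-! ### Union bound over all chains -/

section UnionBound

lemma exp_neg_four_le : Real.exp (-4) ≤ 1 / 8 := by
  have h1 : (2 : ℝ) ≤ Real.exp 1 := by have := Real.add_one_le_exp 1; linarith
  have h2 : (8 : ℝ) ≤ Real.exp 4 := by
    calc (8 : ℝ) ≤ 2 ^ 4 := by norm_num
      _ ≤ Real.exp 1 ^ 4 := by gcongr
      _ = Real.exp 4 := by rw [← Real.exp_nat_mul]; norm_num
  rw [Real.exp_neg, one_div]
  exact inv_anti₀ (by norm_num) h2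

lemma two_pow_le_exp {k : ℕ} {x : ℝ} (h : (k : ℝ) ≤ x) : (2 : ℝ) ^ k ≤ Real.exp x := by
  calc (2 : ℝ) ^ k ≤ (Real.exp 1) ^ k := by
        gcongr; have := Real.add_one_le_exp 1; linarith
    _ = Real.exp k := by rw [← Real.exp_nat_mul, mul_one]
    _ ≤ _ := Real.exp_le_exp.2 h

lemma measure_biUnion_le_card_mul {Ω ι : Type*} [MeasurableSpace Ω] (μ : Measure Ω)
    (s : Finset ι) (A : ι → Set Ω) (a : ℝ) (h : ∀ i ∈ s, μ (A i) ≤ ENNReal.ofReal a) :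
    μ (⋃ i ∈ s, A i) ≤ ENNReal.ofReal (s.card * a) := by
  refine (measure_biUnion_finset_le _ _).trans ((Finset.sum_le_sum h).trans (le_of_eq ?_))
  rw [Finset.sum_const, nsmul_eq_mul, ENNReal.ofReal_mul (by positivity), ENNReal.ofReal_natCast]

variable {Ω Θ : Type*} [MeasurableSpace Ω] [MeasurableSpace Θ] {μ : Measure Ω}
  {m : ℕ} {X : Fin m → Ω → Θ}

/-- A uniform bound over all chains through given finite sets `T n`. -/
lemma exists_exceptional_event [IsProbabilityMeasure μ] (hm : 1 ≤ m)
    (hX : ∀ i, Measurable (X i)) (hind : iIndepFun X μ) {F : Set (Θ → ℝ)}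
    (hF : ∀ f ∈ F, Measurable f) {σ K : ℝ} (hσ : 0 < σ) (hK : 0 < K)
    (hB : BernsteinMoments X μ F σ K) {T : ℕ → Finset (Θ → ℝ)} (hTF : ∀ n, ∀ f ∈ T n, f ∈ F)
    (hcard : ∀ n, (T n).card ≤ 2 ^ 2 ^ n) {Δ : ℝ} (hΔ : 0 < Δ)
    (hΔF : ∀ f ∈ F, ∀ i, ExpBound μ fun ω => (f (X i ω) / Δ) ^ 2)
    {r : ℕ → (Θ → ℝ) → (Θ → ℝ) → ℝ} (hr : ∀ n f g, 0 < r n f g)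
    (hrF : ∀ n, ∀ f ∈ F, ∀ g ∈ F, ∀ i,
      ExpBound μ fun ω => ((f (X i ω) - g (X i ω)) / r n f g) ^ 2)
    {u : ℝ} (hu : 1 ≤ u) {l N : ℕ} (hlu : (2 : ℝ) ^ l ≤ u) (hul : u ≤ 2 ^ (l + 1)) (hlN : l ≤ N)
    (hmN : m ≤ 2 ^ N) {γ : ℝ} :
    ∃ A : Set Ω, μ A ≤ ENNReal.ofReal (Real.exp (-u)) ∧ ∀ ω ∉ A, ∀ p : ℕ → Θ → ℝ,
      (∀ n, p n ∈ T n) →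
      ∑ n ∈ Finset.range N, Real.sqrt (2 ^ n) * r n (p (n + 1)) (p n) ≤ γ →
      avgSquares X μ (p N) ω ≤
        20 * (Real.sqrt u * (σ / Real.sqrt m) + u * (K / m)) +
          60 * (γ ^ 2 / m + Δ / Real.sqrt m * γ) := by
  set W := 10 * (Real.sqrt u * (σ / Real.sqrt m) + u * (K / m)) with hW
  set A₀ : Set Ω := ⋃ f ∈ T l, {ω | W ≤ avgSquares X μ f ω} with hA₀
  set A₁ : ℕ → Set Ω := fun n => ⋃ q ∈ T (n + 1) ×ˢ T n,
    incrementEvent X μ Δ (r n q.1 q.2) n q.1 q.2 with hA₁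
  refine ⟨A₀ ∪ ⋃ n ∈ Finset.Ico l N, A₁ n, ?_, ?_⟩
  · have h0 : μ A₀ ≤ ENNReal.ofReal (Real.exp (-u) / 2) := by
      refine (measure_biUnion_le_card_mul μ _ _ _ fun f hf =>
        hB.measure_avgSquares_ge_le hm hX hind hσ hK (hTF l f hf) (hF f (hTF l f hf))
          (by linarith)).trans (ENNReal.ofReal_le_ofReal ?_)
      have h1 : ((T l).card : ℝ) ≤ Real.exp u :=
        (by exact_mod_cast hcard l : ((T l).card : ℝ) ≤ 2 ^ 2 ^ l).trans
          (two_pow_le_exp (by exact_mod_cast hlu))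
      calc _ ≤ Real.exp u * (2 * Real.exp (-4 * u)) := by gcongr
        _ = Real.exp (-u) * (2 * Real.exp (-2 * u)) := by
            rw [mul_left_comm, mul_left_comm (Real.exp (-u)), ← Real.exp_add, ← Real.exp_add]
            ring_nf
        _ ≤ Real.exp (-u) * (1 / 2) := by
            gcongr
            have h2 : Real.exp (-2 * u) ≤ Real.exp (-2) := Real.exp_le_exp.2 (by linarith)
            have h3 : Real.exp (-2) * Real.exp (-2) = Real.exp (-4) := by
              rw [← Real.exp_add]; norm_num
            have h4 : Real.exp (-2) ≤ 1 / 4 := by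
              have h5 : (4 : ℝ) ≤ Real.exp 2 := by
                have := two_pow_le_exp (k := 2) (x := 2) (by norm_num)
                linarith
              rw [Real.exp_neg, one_div]
              exact inv_anti₀ (by norm_num) h5
            linarith
        _ = _ := by ring
    have h1 : ∀ n ∈ Finset.Ico l N,
        μ (A₁ n) ≤ ENNReal.ofReal (Real.exp (-u) / 4 * (1 / 2) ^ n) := fun n hn => by
      refine (measure_biUnion_le_card_mul μ _ _ (2 * Real.exp (-9 * 2 ^ n))
        fun q hq => ?_).trans (ENNReal.ofReal_le_ofReal ?_)
      · obtain ⟨hq1, hq2⟩ := Finset.mem_product.1 hq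
        have hf := hTF _ _ hq1
        have hg := hTF _ _ hq2
        exact measure_incrementEvent_le hX hind hΔ (hr _ _ _) n (hF _ hf) (hF _ hg)
          (hΔF _ hf) (hΔF _ hg) (hrF n _ hf _ hg)
      -- Counting pairs costs `exp(3·2^n)` and leaves `exp(-6·2^n)`. Of this, `2·2^n ≥ u` since `n ≥
      -- l`, and `4·2^n ≥ 4(n + 1)` makes the sum over `n` geometric.
      · have h2 : (((T (n + 1) ×ˢ T n).card : ℕ) : ℝ) ≤ Real.exp (3 * 2 ^ n) := by
          have h3 : (T (n + 1) ×ˢ T n).card ≤ 2 ^ (3 * 2 ^ n) := by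
            rw [Finset.card_product]
            refine (Nat.mul_le_mul (hcard _) (hcard _)).trans (le_of_eq ?_)
            rw [← pow_add]; congr 1; ring
          exact (by exact_mod_cast h3 : (((T (n + 1) ×ˢ T n).card : ℕ) : ℝ) ≤
            2 ^ (3 * 2 ^ n)).trans (two_pow_le_exp (by push_cast; exact le_rfl))
        have h4 : u ≤ 2 * 2 ^ n := by
          refine hul.trans ?_
          rw [pow_succ, mul_comm]
          gcongr
          · norm_num
          · exact (Finset.mem_Ico.1 hn).1
        have h5 : (n : ℝ) + 1 ≤ 2 ^ n := by exact_mod_cast Nat.lt_two_pow_self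
        calc _ ≤ Real.exp (3 * 2 ^ n) * (2 * Real.exp (-9 * 2 ^ n)) := by gcongr
          _ = 2 * Real.exp (-6 * 2 ^ n) := by
              rw [mul_left_comm, ← Real.exp_add]; ring_nf
          _ ≤ 2 * Real.exp (-u + ((n + 1 : ℕ) : ℝ) * (-4)) := by
              gcongr; push_cast; linarith
          _ = 2 * (Real.exp (-u) * Real.exp (-4) ^ (n + 1)) := by
              rw [Real.exp_add, Real.exp_nat_mul]
          _ ≤ 2 * (Real.exp (-u) * (1 / 8) ^ (n + 1)) := by
              gcongr; exact exp_neg_four_le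
          _ = Real.exp (-u) / 4 * (1 / 8) ^ n := by ring
          _ ≤ _ := by gcongr; norm_num
    have h2 : μ (⋃ n ∈ Finset.Ico l N, A₁ n) ≤ ENNReal.ofReal (Real.exp (-u) / 2) := by
      refine (measure_biUnion_finset_le _ _).trans ((Finset.sum_le_sum h1).trans ?_)
      rw [← ENNReal.ofReal_sum_of_nonneg fun n _ => by positivity, ← Finset.mul_sum]
      refine ENNReal.ofReal_le_ofReal ?_
      have h3 : ∑ n ∈ Finset.Ico l N, (1 / 2 : ℝ) ^ n ≤ 2 :=
        (Finset.sum_le_sum_of_subset_of_nonneg (fun n hn => by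
          simp only [Finset.mem_Ico, Finset.mem_range] at hn ⊢; omega)
          fun n _ _ => by positivity).trans (sum_geometric_two_le N)
      have := Real.exp_pos (-u)
      nlinarith
    refine (measure_union_le _ _).trans ((add_le_add h0 h2).trans (le_of_eq ?_))
    rw [← ENNReal.ofReal_add (by positivity) (by positivity), add_halves]
  · intro ω hω p hp hγ
    simp only [Set.mem_union, not_or, hA₀, hA₁, Set.mem_iUnion, not_exists] at hω
    obtain ⟨hω0, hω1⟩ := hω
    have hpF : ∀ n, p n ∈ F := fun n => hTF n _ (hp n)
    have hpX : ∀ n i, Measurable fun ω => p n (X i ω) := fun n i => (hF _ (hpF n)).comp (hX i)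
    have hω1' : ∀ n, l ≤ n → n < N →
        ω ∉ incrementEvent X μ Δ (r n (p (n + 1)) (p n)) n (p (n + 1)) (p n) := fun n h1 h2 =>
      hω1 n (Finset.mem_Ico.2 ⟨h1, h2⟩) (p (n + 1), p n)
        (Finset.mem_product.2 ⟨hp _, hp _⟩)
    have h := chain_bound hm hlN hmN (fun n i => p n (X i ω))
      (fun n i => ∫ ω', p n (X i ω') ^ 2 ∂μ) (fun n => r n (p (n + 1)) (p n)) hΔ.le
      (fun n => (hr _ _ _).le) hγ (W := W) (not_le.1 (hω0 (p l) (hp l))).le ?_ ?_ ?_ ?_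
    · refine h.trans (le_of_eq ?_)
      rw [hW]; ring
    · intro n h1 h2 h3
      have h4 := hω1' n h1 h2
      rw [incrementEvent, if_pos h3, Set.mem_ofPred_eq, not_le] at h4
      exact h4.le
    · intro n h1 h2 h3
      have h4 := hω1' n h1 h2
      rw [incrementEvent, if_neg (not_lt.2 h3), Set.mem_ofPred_eq, not_le] at h4
      exact h4.le
    · intro n i
      exact (integrable_sq_of_expBound (hpX n i) hΔ (hΔF _ (hpF n) i)).2
    · intro n i
      exact abs_integral_sq_sub_le (hpX (n + 1) i) (hpX n i) hΔ (hr _ _ _) (hΔF _ (hpF _) i)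
        (hΔF _ (hpF _) i) (hrF n _ (hpF _) _ (hpF _) i)

end UnionBound

/-! ### Chains from the functional `γ₂` -/

section Functional

variable {Ω Θ : Type*} [MeasurableSpace Ω] {μ : Measure Ω}
  {m : ℕ} {X : Fin m → Ω → Θ}

lemma dPsi2_self [IsProbabilityMeasure μ] (f : Θ → ℝ) : dPsi2 X μ f f = 0 := by
  simp [dPsi2, psiNorm_zero]

lemma psiNorm_le_radiusPsi2 {F : Set (Θ → ℝ)} {f : Θ → ℝ} (hf : f ∈ F) (i : Fin m) :
    psiNorm 2 (fun ω => f (X i ω)) μ ≤ radiusPsi2 X μ F :=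
  (le_iSup (fun i => psiNorm 2 (fun ω => f (X i ω)) μ) i).trans
    (le_iSup₂ (f := fun f (_ : f ∈ F) => ⨆ i, psiNorm 2 (fun ω => f (X i ω)) μ) f hf)

lemma ofReal_sqrt_two_pow (n : ℕ) :
    ENNReal.ofReal (Real.sqrt (2 ^ n)) = (2 : ℝ≥0∞) ^ ((n : ℝ) / 2) := by
  rw [Real.sqrt_eq_rpow, ← Real.rpow_natCast, ← Real.rpow_mul (by norm_num),
    ← ENNReal.ofReal_rpow_of_pos (by norm_num)]
  simp [div_eq_mul_inv]

lemma IsAdmissible.finite {E : Type*} {F : Set E} {S : ℕ → Set E} (hS : IsAdmissible F S)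
    (n : ℕ) : (S n).Finite ∧ (S n).ncard ≤ 2 ^ 2 ^ n := by
  have h : (S n).encard ≤ ((2 ^ 2 ^ n : ℕ) : ℕ∞) := by
    rcases Nat.eq_zero_or_pos n with rfl | hn
    · rw [hS.card_zero]; exact_mod_cast Nat.one_le_two_pow
    · exact hS.card_le n hn
  have hfin := Set.finite_of_encard_le_coe h
  refine ⟨hfin, ?_⟩
  rw [← hfin.cast_ncard_eq] at h
  exact_mod_cast h

/-- A chain of best approximations of `f`, stopped at `f` itself from level `N` on. -/
lemma exists_chain [IsProbabilityMeasure μ] {F : Set (Θ → ℝ)} {S : ℕ → Set (Θ → ℝ)}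
    (hS : IsAdmissible F S) {γ : ℝ}
    (hγ : ⨆ t ∈ F, ∑' n : ℕ, (2 : ℝ≥0∞) ^ ((n : ℝ) / 2) * ⨅ s ∈ S n, dPsi2 X μ t s ≤
      ENNReal.ofReal γ) (hγ0 : 0 ≤ γ) {f : Θ → ℝ} (hf : f ∈ F) (N : ℕ) :
    ∃ p : ℕ → Θ → ℝ, (∀ n < N, p n ∈ S n) ∧ (∀ n, N ≤ n → p n = f) ∧
      (∀ n, dPsi2 X μ f (p n) < ∞) ∧
      ∀ M, ∑ n ∈ Finset.range M, Real.sqrt (2 ^ n) * (dPsi2 X μ f (p n)).toReal ≤ γ := by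
  have hsum : ∑' n : ℕ, (2 : ℝ≥0∞) ^ ((n : ℝ) / 2) * ⨅ s ∈ S n, dPsi2 X μ f s ≤
      ENNReal.ofReal γ :=
    (le_iSup₂ (f := fun t (_ : t ∈ F) => ∑' n : ℕ,
      (2 : ℝ≥0∞) ^ ((n : ℝ) / 2) * ⨅ s ∈ S n, dPsi2 X μ t s) f hf).trans hγ
  have hpos : ∀ n : ℕ, (2 : ℝ≥0∞) ^ ((n : ℝ) / 2) ≠ 0 := fun n => by
    rw [← ofReal_sqrt_two_pow]; simp
  have hfin : ∀ n, ⨅ s ∈ S n, dPsi2 X μ f s < ∞ := fun n => by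
    have h1 := ((ENNReal.le_tsum n).trans hsum).trans_lt ENNReal.ofReal_lt_top
    by_contra h2
    rw [not_lt, top_le_iff] at h2
    rw [h2, ENNReal.mul_top (hpos n)] at h1
    exact lt_irrefl _ h1
  -- An admissible sequence may have empty sets at positive levels; the infimum over one would be
  -- `∞`, which the finite sum excludes.
  have hbest : ∀ n, ∃ s ∈ S n, dPsi2 X μ f s ≤ ⨅ s ∈ S n, dPsi2 X μ f s := fun n => by
    have hne : (S n).Nonempty := by
      by_contra h
      have h1 := hfin n
      rw [Set.not_nonempty_iff_eq_empty.1 h] at h1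
      simp at h1
    obtain ⟨s, hs, hmin⟩ := Set.exists_min_image (S n) (dPsi2 X μ f) (hS.finite n).1 hne
    exact ⟨s, hs, le_iInf₂ hmin⟩
  choose π hπ hπle using hbest
  set p : ℕ → Θ → ℝ := fun n => if n < N then π n else f with hp
  have hple : ∀ n, dPsi2 X μ f (p n) ≤ ⨅ s ∈ S n, dPsi2 X μ f s := fun n => by
    by_cases h : n < N
    · simpa [hp, h] using hπle n
    · simp [hp, h, dPsi2_self]
  refine ⟨p, fun n hn => by simpa [hp, hn] using hπ n, fun n hn => by simp [hp, not_lt.2 hn],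
    fun n => (hple n).trans_lt (hfin n), fun M => ?_⟩
  rw [← ENNReal.ofReal_le_ofReal_iff hγ0, ENNReal.ofReal_sum_of_nonneg fun n _ => by positivity]
  refine (Finset.sum_le_sum fun n _ => ?_).trans ((ENNReal.sum_le_tsum (Finset.range M)).trans hsum)
  rw [ENNReal.ofReal_mul (by positivity), ofReal_sqrt_two_pow,
    ENNReal.ofReal_toReal ((hple n).trans_lt (hfin n)).ne]
  gcongr
  exact hple n

variable [MeasurableSpace Θ]

lemma dPsi2_le_add [IsProbabilityMeasure μ] (hX : ∀ i, Measurable (X i)) {f g h : Θ → ℝ}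
    (hf : Measurable f) (hh : Measurable h) :
    dPsi2 X μ g h ≤ dPsi2 X μ f g + dPsi2 X μ f h := by
  refine iSup_le fun i => ?_
  have h1 : (fun ω => g (X i ω) - h (X i ω)) =
      fun ω => (f (X i ω) - h (X i ω)) - (f (X i ω) - g (X i ω)) := by
    ext ω; ring
  rw [h1, add_comm]
  refine (psiNorm_sub_le (by have := hX i; fun_prop)).trans (add_le_add ?_ ?_)
  · exact le_iSup (fun i => psiNorm 2 (fun ω => f (X i ω) - h (X i ω)) μ) i
  · exact le_iSup (fun i => psiNorm 2 (fun ω => f (X i ω) - g (X i ω)) μ) i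

lemma dPsi2_le_two_mul_radiusPsi2 [IsProbabilityMeasure μ] (hX : ∀ i, Measurable (X i))
    {F : Set (Θ → ℝ)} {f g : Θ → ℝ} (hf : f ∈ F) (hg : g ∈ F) (hfm : Measurable f) :
    dPsi2 X μ f g ≤ 2 * radiusPsi2 X μ F := by
  refine iSup_le fun i => ?_
  rw [two_mul]
  exact (psiNorm_sub_le (hfm.comp (hX i))).trans
    (add_le_add (psiNorm_le_radiusPsi2 hf i) (psiNorm_le_radiusPsi2 hg i))

/-- The term of level 0 bounds the distance of every `f` to the single element of `S 0`, whose own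
norm is finite by the moment condition. -/
lemma radiusPsi2_lt_top [IsProbabilityMeasure μ] (hm : 1 ≤ m) (hX : ∀ i, Measurable (X i))
    {F : Set (Θ → ℝ)} (hF : ∀ f ∈ F, Measurable f) {σ K : ℝ} (hK : 0 < K)
    (hB : BernsteinMoments X μ F σ K) {S : ℕ → Set (Θ → ℝ)} (hS : IsAdmissible F S)
    (hfin : ⨆ t ∈ F, ∑' n : ℕ, (2 : ℝ≥0∞) ^ ((n : ℝ) / 2) * ⨅ s ∈ S n, dPsi2 X μ t s < ∞) :
    radiusPsi2 X μ F < ∞ := by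
  obtain ⟨s, hs⟩ := Set.encard_eq_one.1 hS.card_zero
  have hsF : s ∈ F := hS.subset 0 (by rw [hs]; rfl)
  have h1 : ⨆ i, psiNorm 2 (fun ω => s (X i ω)) μ < ∞ := by
    have : Nonempty (Fin m) := ⟨⟨0, by omega⟩⟩
    obtain ⟨i, hi⟩ := exists_eq_ciSup_of_finite (f := fun i => psiNorm 2 (fun ω => s (X i ω)) μ)
    rw [← hi]
    exact hB.psiNorm_lt_top hm hX hK hsF (hF s hsF) i
  refine lt_of_le_of_lt (iSup₂_le fun f hf => iSup_le fun i => ?_)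
    (ENNReal.add_lt_top.2 ⟨hfin, h1⟩)
  have h2 : (fun ω => f (X i ω)) = fun ω => (f (X i ω) - s (X i ω)) - (-s (X i ω)) := by
    ext ω; ring
  have hfm := hF f hf
  have hsm := hF s hsF
  rw [h2]
  refine (psiNorm_sub_le (by have := hX i; fun_prop)).trans (add_le_add ?_ ?_)
  · refine le_trans ?_ (le_iSup₂ (f := fun t (_ : t ∈ F) => ∑' n : ℕ,
      (2 : ℝ≥0∞) ^ ((n : ℝ) / 2) * ⨅ s ∈ S n, dPsi2 X μ t s) f hf)
    refine le_trans ?_ (ENNReal.le_tsum 0)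
    rw [hs]
    simp only [Nat.cast_zero, zero_div, ENNReal.rpow_zero, one_mul, Set.mem_singleton_iff,
      iInf_iInf_eq_left]
    exact le_iSup (fun i => psiNorm 2 (fun ω => f (X i ω) - s (X i ω)) μ) i
  · rw [psiNorm_neg]
    exact le_iSup (fun i => psiNorm 2 (fun ω => s (X i ω)) μ) i

/-- The tail bound for real parameters `Δ` and `γ` exceeding the radius and the functional. -/
lemma exists_event_avgSquares_le [IsProbabilityMeasure μ] (hm : 1 ≤ m)
    (hX : ∀ i, Measurable (X i)) (hind : iIndepFun X μ) {F : Set (Θ → ℝ)}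
    (hF : ∀ f ∈ F, Measurable f) {σ K : ℝ} (hσ : 0 < σ) (hK : 0 < K)
    (hB : BernsteinMoments X μ F σ K) {G : Set (Θ → ℝ)} (hGF : G ⊆ F) (hG : G.Finite)
    {u : ℝ} (hu : 1 ≤ u) {Δ γ : ℝ} (hΔ : radiusPsi2 X μ F < ENNReal.ofReal Δ)
    (hγ : gammaFunctional 2 F (dPsi2 X μ) < ENNReal.ofReal γ) :
    ∃ A : Set Ω, μ A ≤ ENNReal.ofReal (Real.exp (-u)) ∧ ∀ ω ∉ A, ∀ f ∈ G,
      avgSquares X μ f ω ≤ 20 * (Real.sqrt u * (σ / Real.sqrt m) + u * (K / m)) +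
        540 * (γ ^ 2 / m + Δ / Real.sqrt m * γ) := by
  have hΔ0 : 0 < Δ := ENNReal.ofReal_pos.1 (pos_of_gt hΔ)
  have hγ0 : 0 < γ := ENNReal.ofReal_pos.1 (pos_of_gt hγ)
  simp only [gammaFunctional, iInf_lt_iff] at hγ
  obtain ⟨S, hS, hSγ⟩ := hγ
  obtain ⟨l, hlu, hul⟩ := exists_nat_pow_near hu one_lt_two
  -- Large enough for `l ≤ N`, `m ≤ 2^N`, and for `G` to respect the cardinality bound at every
  -- level from `N` on.
  set N := l + m + G.ncard with hN
  set T : ℕ → Finset (Θ → ℝ) := fun n =>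
    if n < N then (hS.finite n).1.toFinset else hG.toFinset with hT
  have hTF : ∀ n, ∀ f ∈ T n, f ∈ F := fun n f hf => by
    by_cases h : n < N
    · simp only [hT, h, if_true, Set.Finite.mem_toFinset] at hf
      exact hS.subset n hf
    · simp only [hT, h, if_false, Set.Finite.mem_toFinset] at hf
      exact hGF hf
  have hcard : ∀ n, (T n).card ≤ 2 ^ 2 ^ n := fun n => by
    by_cases h : n < N
    · simp only [hT, h, if_true]
      rw [← Set.ncard_eq_toFinset_card _ (hS.finite n).1]
      exact (hS.finite n).2
    · simp only [hT, h, if_false]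
      rw [← Set.ncard_eq_toFinset_card _ hG]
      have h1 : n < 2 ^ n := Nat.lt_two_pow_self
      have h2 : 2 ^ n < 2 ^ 2 ^ n := Nat.lt_two_pow_self
      omega
  have hmN : m ≤ 2 ^ N := by
    have : N < 2 ^ N := Nat.lt_two_pow_self
    omega
  -- The padding makes `r` positive and strictly larger than the distance; weighted by `2^(n/2)` it
  -- adds at most `γ / 2` in total. A link costs two distances to `f`, whence `3 * γ` below, and
  -- `540 = 60·9`.
  set r : ℕ → (Θ → ℝ) → (Θ → ℝ) → ℝ :=
    fun n f g => (dPsi2 X μ f g).toReal + γ / 4 * (1 / 4) ^ n with hr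
  have hr0 : ∀ n f g, 0 < r n f g := fun n f g => by positivity
  obtain ⟨A, hA, hAω⟩ := exists_exceptional_event hm hX hind hF hσ hK hB hTF hcard hΔ0
    (fun f hf i => expBound_of_psiNorm_lt ((psiNorm_le_radiusPsi2 hf i).trans_lt hΔ)) hr0
    (fun n f hf g hg i => expBound_of_psiNorm_lt (by
      have hfin : dPsi2 X μ f g < ∞ := (dPsi2_le_two_mul_radiusPsi2 hX hf hg (hF f hf)).trans_lt
        (ENNReal.mul_lt_top (by simp) (hΔ.trans ENNReal.ofReal_lt_top))
      refine (le_iSup (fun i => psiNorm 2 (fun ω => f (X i ω) - g (X i ω)) μ) i).trans_lt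
        ((ENNReal.lt_ofReal_iff_toReal_lt hfin.ne).2 ?_)
      have : 0 < γ / 4 * (1 / 4) ^ n := by positivity
      change (dPsi2 X μ f g).toReal < _
      simp only [hr]; linarith))
    hu hlu hul.le (by omega) hmN (γ := 3 * γ)
  refine ⟨A, hA, fun ω hω f hf => ?_⟩
  obtain ⟨p, hp1, hp2, hpfin, hpsum⟩ := exists_chain hS hSγ.le hγ0.le (hGF hf) N
  have hpT : ∀ n, p n ∈ T n := fun n => by
    by_cases h : n < N
    · simpa [hT, h] using hp1 n h
    · simpa [hT, h, hp2 n (not_lt.1 h)] using hf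
  have hfm := hF f (hGF hf)
  have hpm : ∀ n, Measurable (p n) := fun n => hF _ (hTF n _ (hpT n))
  have h := hAω ω hω p hpT ?_
  · rw [hp2 N le_rfl] at h
    refine h.trans ?_
    have h1 : 0 ≤ Δ / Real.sqrt m * γ := by positivity
    have h2 : (3 * γ) ^ 2 / m = 9 * (γ ^ 2 / m) := by ring
    rw [h2]
    linarith
  · set D : ℕ → ℝ := fun n => (dPsi2 X μ f (p n)).toReal with hD
    have hD0 : ∀ n, 0 ≤ D n := fun n => ENNReal.toReal_nonneg
    have h1 : ∀ n ∈ Finset.range N, Real.sqrt (2 ^ n) * r n (p (n + 1)) (p n) ≤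
        Real.sqrt (2 ^ (n + 1)) * D (n + 1) + Real.sqrt (2 ^ n) * D n +
          γ / 4 * (1 / 2) ^ n := fun n _ => by
      have h2 : (dPsi2 X μ (p (n + 1)) (p n)).toReal ≤ D (n + 1) + D n := by
        rw [hD, ← ENNReal.toReal_add (hpfin _).ne (hpfin _).ne]
        exact ENNReal.toReal_mono (ENNReal.add_lt_top.2 ⟨hpfin _, hpfin _⟩).ne
          (dPsi2_le_add hX hfm (hpm n))
      have h3 : Real.sqrt (2 ^ n) ≤ Real.sqrt (2 ^ (n + 1)) :=
        Real.sqrt_le_sqrt (pow_le_pow_right₀ (by norm_num) (by omega))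
      have h4 : Real.sqrt (2 ^ n) ≤ 2 ^ n :=
        Real.sqrt_le_iff.2 ⟨by positivity, le_self_pow₀ (one_le_pow₀ (by norm_num)) (by norm_num)⟩
      have h5 : Real.sqrt (2 ^ n) * (γ / 4 * (1 / 4) ^ n) ≤ γ / 4 * (1 / 2) ^ n := by
        calc _ ≤ 2 ^ n * (γ / 4 * (1 / 4) ^ n) := by gcongr
          _ = γ / 4 * (2 * (1 / 4)) ^ n := by rw [mul_pow]; ring
          _ = _ := by norm_num
      calc _ ≤ Real.sqrt (2 ^ n) * (D (n + 1) + D n + γ / 4 * (1 / 4) ^ n) := by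
            gcongr
            simp only [hr]; linarith
        _ = Real.sqrt (2 ^ n) * D (n + 1) + Real.sqrt (2 ^ n) * D n +
            Real.sqrt (2 ^ n) * (γ / 4 * (1 / 4) ^ n) := by ring
        _ ≤ _ := by
            have := mul_le_mul_of_nonneg_right h3 (hD0 (n + 1))
            linarith
    refine (Finset.sum_le_sum h1).trans ?_
    rw [Finset.sum_add_distrib, Finset.sum_add_distrib, ← Finset.mul_sum]
    have h6 := hpsum (N + 1)
    rw [Finset.sum_range_succ'] at h6
    have h7 : 0 ≤ Real.sqrt (2 ^ 0) * (dPsi2 X μ f (p 0)).toReal := by positivity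
    have h8 := hpsum N
    have h9 := mul_le_mul_of_nonneg_left (sum_geometric_two_le N) (by positivity : 0 ≤ γ / 4)
    linarith

end Functional

theorem corollary5p7 :
    ∃ c C : ℝ, 0 < c ∧ 0 < C ∧
      ∀ {Ω Θ : Type*} [MeasurableSpace Ω] [MeasurableSpace Θ]
        (μ : Measure Ω) [IsProbabilityMeasure μ]
        (m : ℕ) (_ : 1 ≤ m) (X : Fin m → Ω → Θ)
        (_ : ∀ i, Measurable (X i)) (_ : iIndepFun X μ)
        (F : Set (Θ → ℝ)) (_ : ∀ f ∈ F, Measurable f)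
        (σ K : ℝ) (_ : 0 < σ) (_ : 0 < K) (_ : BernsteinMoments X μ F σ K)
        (G : Set (Θ → ℝ)) (_ : G ⊆ F) (_ : G.Finite) (u : ℝ) (_ : 1 ≤ u),
        μ {ω | ENNReal.ofReal C *
                ((1 / (m : ℝ≥0∞)) * gammaFunctional 2 F (dPsi2 X μ) ^ 2 +
                  radiusPsi2 X μ F / ENNReal.ofReal (Real.sqrt m) *
                    gammaFunctional 2 F (dPsi2 X μ)) +
              ENNReal.ofReal (c * (Real.sqrt u * (σ / Real.sqrt m) + u * (K / m)))
            ≤ ⨆ f ∈ G, ENNReal.ofReal (avgSquares X μ f ω)}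
          ≤ ENNReal.ofReal (Real.exp (-u)) := by
  refine ⟨21, 540, by norm_num, by norm_num, ?_⟩
  intro Ω Θ _ _ μ _ m hm X hX hind F hF σ K hσ hK hB G hGF hG u hu
  have hm0 : (0 : ℝ) < m := by exact_mod_cast hm
  have hw0 : 0 < Real.sqrt m := Real.sqrt_pos.2 hm0
  set W := Real.sqrt u * (σ / Real.sqrt m) + u * (K / m) with hW
  have hW0 : 0 < W := by positivity
  -- Finiteness of `G` keeps the inequality strict; `0 < a` covers empty `G`.
  have hsup : ∀ (ω : Ω) (a : ℝ≥0∞), 0 < a → (∀ f ∈ G, ENNReal.ofReal (avgSquares X μ f ω) < a) →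
      ⨆ f ∈ G, ENNReal.ofReal (avgSquares X μ f ω) < a := fun ω a ha h => by
    have h1 : ⨆ f ∈ G, ENNReal.ofReal (avgSquares X μ f ω) =
        hG.toFinset.sup fun f => ENNReal.ofReal (avgSquares X μ f ω) := by
      simp [Finset.sup_eq_iSup]
    rw [h1, Finset.sup_lt_iff (by simpa using ha)]
    simpa using h
  -- If `γ₂ = ∞`, the term `γ₂² / m` alone makes the threshold infinite. Otherwise the radius is
  -- finite, so the convention `∞ · 0 = 0` plays no role.
  rcases eq_or_ne (gammaFunctional 2 F (dPsi2 X μ)) ∞ with htop | htop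
  · have hempty : ∀ ω, ¬ (ENNReal.ofReal 540 *
        ((1 / (m : ℝ≥0∞)) * gammaFunctional 2 F (dPsi2 X μ) ^ 2 +
          radiusPsi2 X μ F / ENNReal.ofReal (Real.sqrt m) * gammaFunctional 2 F (dPsi2 X μ)) +
        ENNReal.ofReal (21 * W) ≤ ⨆ f ∈ G, ENNReal.ofReal (avgSquares X μ f ω)) := fun ω => by
      rw [not_le]
      have hm' : (1 / (m : ℝ≥0∞)) ≠ 0 := by simp
      have : ENNReal.ofReal 540 * ((1 / (m : ℝ≥0∞)) * gammaFunctional 2 F (dPsi2 X μ) ^ 2 +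
          radiusPsi2 X μ F / ENNReal.ofReal (Real.sqrt m) * gammaFunctional 2 F (dPsi2 X μ)) +
          ENNReal.ofReal (21 * W) = ∞ := by
        rw [htop, ENNReal.top_pow (by norm_num), ENNReal.mul_top hm', top_add,
          ENNReal.mul_top (by simp), top_add]
      rw [this]
      exact hsup ω ∞ (by simp) fun f _ => ENNReal.ofReal_lt_top
    simp only [hempty]
    simp
  · have hR : radiusPsi2 X μ F < ∞ := by
      have h1 : gammaFunctional 2 F (dPsi2 X μ) < ∞ := lt_top_iff_ne_top.2 htop
      simp only [gammaFunctional, iInf_lt_iff] at h1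
      obtain ⟨S, hS, hSγ⟩ := h1
      exact radiusPsi2_lt_top hm hX hF hK hB hS hSγ
    set γ := (gammaFunctional 2 F (dPsi2 X μ)).toReal with hγ
    set Δ := (radiusPsi2 X μ F).toReal with hΔ
    have hγeq : gammaFunctional 2 F (dPsi2 X μ) = ENNReal.ofReal γ :=
      (ENNReal.ofReal_toReal htop).symm
    have hΔeq : radiusPsi2 X μ F = ENNReal.ofReal Δ := (ENNReal.ofReal_toReal hR.ne).symm
    have hγ0 : 0 ≤ γ := ENNReal.toReal_nonneg
    have hΔ0 : 0 ≤ Δ := ENNReal.toReal_nonneg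
    have hthr : ENNReal.ofReal 540 *
        ((1 / (m : ℝ≥0∞)) * gammaFunctional 2 F (dPsi2 X μ) ^ 2 +
          radiusPsi2 X μ F / ENNReal.ofReal (Real.sqrt m) * gammaFunctional 2 F (dPsi2 X μ)) +
        ENNReal.ofReal (21 * W) =
        ENNReal.ofReal (540 * (γ ^ 2 / m + Δ / Real.sqrt m * γ) + 21 * W) := by
      clear_value W
      rw [ENNReal.ofReal_add (by positivity) (by positivity),
        ENNReal.ofReal_mul (p := 540) (by positivity), ENNReal.ofReal_add (by positivity) (by positivity),
        ENNReal.ofReal_mul (p := Δ / Real.sqrt m) (by positivity), ENNReal.ofReal_div_of_pos hw0,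
        ENNReal.ofReal_div_of_pos hm0, ENNReal.ofReal_pow hγ0, ENNReal.ofReal_natCast, ← hγeq,
        ← hΔeq, one_div, ENNReal.div_eq_inv_mul (a := gammaFunctional 2 F (dPsi2 X μ) ^ 2)]
    rw [hthr]
    -- The chaining bound needs parameters strictly above the radius and `γ₂`. By continuity a small
    -- shift costs less than `W`, which is why `c` is 21 and not 20; this also gives the strict
    -- inequality that excludes equality with the threshold.
    obtain ⟨δ, hδ0, hδ⟩ : ∃ δ : ℝ, 0 < δ ∧
        540 * ((γ + δ) ^ 2 / m + (Δ + δ) / Real.sqrt m * (γ + δ)) <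
          540 * (γ ^ 2 / m + Δ / Real.sqrt m * γ) + W := by
      have hcont : Continuous fun δ : ℝ =>
          540 * ((γ + δ) ^ 2 / m + (Δ + δ) / Real.sqrt m * (γ + δ)) := by fun_prop
      have hev := hcont.continuousAt (x := 0) |>.eventually_lt_const
        (u := 540 * (γ ^ 2 / m + Δ / Real.sqrt m * γ) + W) (by simpa using hW0)
      obtain ⟨δ, h1, h2⟩ := ((hev.filter_mono nhdsWithin_le_nhds).and
        (self_mem_nhdsWithin : Set.Ioi (0 : ℝ) ∈ nhdsWithin 0 (Set.Ioi 0))).exists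
      exact ⟨δ, h2, h1⟩
    obtain ⟨A, hA, hAω⟩ := exists_event_avgSquares_le hm hX hind hF hσ hK hB hGF hG hu
      (Δ := Δ + δ) (γ := γ + δ)
      (by rw [hΔeq]; exact (ENNReal.ofReal_lt_ofReal_iff (by linarith)).2 (by linarith))
      (by rw [hγeq]; exact (ENNReal.ofReal_lt_ofReal_iff (by linarith)).2 (by linarith))
    refine (measure_mono fun ω hω => ?_).trans hA
    by_contra hωA
    refine absurd hω (not_le.2 (hsup ω _ (ENNReal.ofReal_pos.2 (by positivity)) fun f hf => ?_))
    refine (ENNReal.ofReal_lt_ofReal_iff (by positivity)).2 ?_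
    have := hAω ω hωA f hf
    linarith
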